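/- Let $G$ be a finite group and $p$ a prime. Let $R$ be the ring of all algebraic integers in $\mathbb{C}$, $K$ its quotient field, $I$ a maximal ideal of $R$ containing $p$, and $F=R/I$. Brauer characters of $G$ are formed with respect to $(K,R,F)$ and are extended by $0$ to the $p$-singular elements; $\operatorname{IBr}(G)$ denotes the set of irreducible ones and $\operatorname{Irr}(G)$ the set of irreducible $K$-characters. The decomposition numbers $d_{\chi\varphi}\in\mathbb{N}_0$ are defined by $\chi|_{G_{p'}}=\sum_{\varphi\in\operatorname{IBr}(G)}d_{\chi\varphi}\,\varphi$ for $\chi\in\operatorname{Irr}(G)$. The projective indecomposable character (PIM) corresponding to $\varphi\in\operatorname{IBr}(G)$ is $\sum_{\chi\in\operatorname{Irr}(G)}d_{\chi\varphi}\,\chi$, and a (genuine) projective character is a linear combination of PIMs with coefficients in $\mathbb{N}_0$. Write $\langle\lambda,\mu\rangle=\frac1{|G|}\sum_{g\in G}\lambda(g)\overline{\mu(g)}$. Let $B$ be a union of $p$-blocks of $G$ with irreducible Brauer characters $\beta_1,\dots,\beta_s$ and corresponding PIMs $\Pi_1,\dots,\Pi_s$. Let $\varphi_1,\dots,\varphi_s$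 be Brauer characters forming a $\mathbb{Z}$-basis of $\bigoplus_i\mathbb{Z}\beta_i$, and let $\Phi_1,\dots,\Phi_s$ be projective characters forming a $\mathbb{Z}$-basis of $\bigoplus_i\mathbb{Z}\Pi_i$. Put $a_{ij}=\langle\varphi_i,\Phi_j\rangle$. Assume that the matrix $(a_{ij})$ is lower unitriangular, i.e. $a_{ij}=0$ for $j>i$ and $a_{ii}=1$, and that the PIMs are ordered consistently, i.e. for every $j$ $$\Phi_j=\Pi_j+\sum_{r=j+1}^{s}b_{rj}\Pi_r\qquad\text{with } b_{rj}\in\mathbb{N}_0 .$$ Then all $a_{ij}$ are non-negative integers, and the following hold. (a) Let $\Phi=\sum_{j=1}^{s}v_j\Phi_j$ $(v_j\in\mathbb{Z})$ be a projective character. Suppose that $v_i<0$ for some $i$, and that there is $j_0<i$ with $v_{j_0}>0$ and $$|v_i|>\sum_{\substack{1\le j\le i-1\\ j\ne j_0,\ v_j>0}}v_ja_{ij}.$$ Then $\Pi_i$ is contained in $\Phi_{j_0}$ at least $z$ times, where $$z=\Bigl\lceil\frac1{v_{j_0}}\Bigl(|v_i|-\sum_{\substack{1\le j\le i-1\\ j\ne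 j_0,\ v_j>0}}v_ja_{ij}\Bigr)\Bigr\rceil .$$ (b) Let $j_0<i$ and let $z\in\mathbb{N}_0$ be such that $\Pi_i$ is contained in $\Phi_{j_0}$ at least $z$ times. Then $$\Phi_{j_0}-z\,\Phi_i+z\sum_{l=i+1}^{s}a_{li}\,\Phi_l$$ is a genuine projective character. Here a PIM $\Pi$ is contained at least $z$ times in a projective character $\Psi$ if its coefficient in the expression of $\Psi$ as an $\mathbb{N}_0$-linear combination of PIMs is at least $z$. -/

import Mathlib

noncomputable section

namespace ModChar

/-- The ring `R` of all algebraic integers, inside `ℂ`. -/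
abbrev AlgInt : Type := integralClosure ℤ ℂ

/-- The quotient field `K` of `R`: the field of all algebraic numbers, inside `ℂ`. -/
abbrev AlgNum : Type := algebraicClosure ℚ ℂ

/-- The residue class ring `F = R / I`; a field, since `I` will be maximal. -/
abbrev Residue (I : Ideal AlgInt) : Type := AlgInt ⧸ I

instance instFieldResidue (I : Ideal AlgInt) [I.IsMaximal] : Field (Residue I) :=
  Ideal.Quotient.field I

section Definitions

variable (p : ℕ) (I : Ideal AlgInt) [I.IsMaximal] (G : Type*) [Group G]

/-- The inverse of the reduction map `ρ` from the `m`-th roots of unity in `R` to those in `F`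
(bijective when `I` contains a prime `p` that does not divide `m`). -/
def liftRoot (m : ℕ) (x : Residue I) : ℂ :=
  ((Function.invFunOn (Ideal.Quotient.mk I) {r : AlgInt | r ^ m = 1} x : AlgInt) : ℂ)

variable {G}

/-- The Brauer character of an `F`-representation `X` of `G`, extended by `0` to the `p`-singular
elements: at a `p`-regular `g` it is the sum of the lifts of the eigenvalues of `X g`, counted with
multiplicity. The lifts are roots of unity of order dividing the `p'`-part of `|G|`. -/
def brauerChar {n : ℕ} (X : Representation (Residue I) G (Fin n → Residue I)) : G → ℂ := fun g =>
  if p ∣ orderOf g then 0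
  else ((X g).charpoly.roots.map (liftRoot I (ordCompl[p] (Nat.card G)))).sum

/-- `θ` is a Brauer character of `G`, i.e. afforded by some representation over `F`. -/
def IsBrauerCharacter (θ : G → ℂ) : Prop :=
  ∃ (n : ℕ) (X : Representation (Residue I) G (Fin n → Residue I)), θ = brauerChar p I X

variable (G)

/-- `IBr(G)`, the set of irreducible Brauer characters. -/
def IBr : Set (G → ℂ) :=
  {θ | ∃ (n : ℕ) (X : Representation (Residue I) G (Fin n → Residue I)),
    X.IsIrreducible ∧ θ = brauerChar p I X}

/-- `Irr(G)`, the set of characters of irreducible `K`-representations. -/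
def Irr : Set (G → ℂ) :=
  {χ | ∃ (n : ℕ) (X : Representation AlgNum G (Fin n → AlgNum)),
    X.IsIrreducible ∧ χ = fun g => ((X.character g : AlgNum) : ℂ)}

variable {G}

/-- Restriction to the `p`-regular elements, extended by `0`. -/
def regRestrict (χ : G → ℂ) : G → ℂ := fun g => if p ∣ orderOf g then 0 else χ g

open Classical in
/-- The decomposition number `d_{χφ}`: the coefficient of `φ` in the expression of the restriction
of `χ` to the `p`-regular elements as a combination of irreducible Brauer characters with
non-negative integral coefficients. (Such an expression exists for all `χ ∈ Irr(G)`, and it is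
unique as `IBr(G)` is linearly independent.) -/
def decompNumber (χ φ : G → ℂ) : ℕ :=
  if h : ∃ d : (G → ℂ) →₀ ℕ, (d.support : Set (G → ℂ)) ⊆ IBr p I G ∧
      regRestrict p χ = d.sum fun ψ k => k • ψ
  then h.choose φ else 0

/-- The projective indecomposable character (PIM) `∑_{χ ∈ Irr(G)} d_{χφ} χ` corresponding to the
irreducible Brauer character `φ`. -/
def pim (φ : G → ℂ) : G → ℂ := ∑ᶠ χ ∈ Irr G, decompNumber p I χ φ • χ

/-- (Genuine) projective characters: combinations of PIMs with coefficients in `ℕ`. -/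
def IsProjectiveCharacter (Φ : G → ℂ) : Prop :=
  Φ ∈ AddSubmonoid.closure (pim p I '' IBr p I G)

/-- The PIM corresponding to `φ` is contained at least `z` times in the projective character `Φ`:
`Φ` is a combination of PIMs with coefficients in `ℕ` in which the PIM corresponding to `φ` has
coefficient at least `z`. -/
def ContainedTimes (z : ℕ) (φ Φ : G → ℂ) : Prop :=
  ∃ m : (G → ℂ) →₀ ℕ, (m.support : Set (G → ℂ)) ⊆ IBr p I G ∧
    Φ = (m.sum fun ψ k => k • pim p I ψ) ∧ z ≤ m φ

/-- The usual inner product of class functions. -/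
def charInner [Fintype G] (lam mu : G → ℂ) : ℂ :=
  (Nat.card G : ℂ)⁻¹ * ∑ g : G, lam g * (starRingEnd ℂ) (mu g)

variable (G)

/-- The Brauer graph: distinct `χ, ψ ∈ Irr(G)` are linked if they have a common modular
constituent. -/
def brauerGraph : SimpleGraph (Irr G) where
  Adj χ ψ := χ ≠ ψ ∧ ∃ φ ∈ IBr p I G, decompNumber p I χ.1 φ ≠ 0 ∧ decompNumber p I ψ.1 φ ≠ 0
  symm := ⟨fun _ _ h => ⟨h.1.symm, h.2.imp fun _ k => ⟨k.1, k.2.2, k.2.1⟩⟩⟩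
  loopless := ⟨fun _ h => h.1 rfl⟩

variable {G}

/-- `B ⊆ Irr(G)` is a union of blocks, i.e. of connected components of the Brauer graph. -/
def IsUnionOfBlocks (B : Set (G → ℂ)) : Prop :=
  ∃ C : Set (brauerGraph p I G).ConnectedComponent, B = Subtype.val '' (⋃ c ∈ C, c.supp)

/-- `IBr(B)`: the irreducible Brauer characters belonging to the union of blocks `B`. -/
def IBrBlock (B : Set (G → ℂ)) : Set (G → ℂ) :=
  {φ | φ ∈ IBr p I G ∧ ∃ χ ∈ B, decompNumber p I χ φ ≠ 0}

/-- A basic set of Brauer characters of `B`: a `ℤ`-basis, consisting of Brauer characters, of the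
group of `ℤ`-linear combinations of `IBr(B)`. -/
structure IsBrauerBasicSet (B : Set (G → ℂ)) {s : ℕ} (φ : Fin s → G → ℂ) : Prop where
  isBrauerCharacter : ∀ i, IsBrauerCharacter p I (φ i)
  linearIndependent : LinearIndependent ℤ φ
  span_eq : Submodule.span ℤ (Set.range φ) = Submodule.span ℤ (IBrBlock p I B)

/-- A basic set of projective characters of `B`: a `ℤ`-basis, consisting of projective characters,
of the group of `ℤ`-linear combinations of the PIMs belonging to `B`. -/
structure IsProjectiveBasicSet (B : Set (G → ℂ)) {s : ℕ} (Φ : Fin s → G → ℂ) : Prop where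
  isProjectiveCharacter : ∀ i, IsProjectiveCharacter p I (Φ i)
  linearIndependent : LinearIndependent ℤ Φ
  span_eq : Submodule.span ℤ (Set.range Φ) = Submodule.span ℤ (pim p I '' IBrBlock p I B)

end Definitions

/-- The integer `|v_i| - ∑ v_j a_{ij}`, the sum over all `j < i` with `j ≠ j₀` and `v_j > 0`. -/
def excess {s : ℕ} (a : Fin s → Fin s → ℕ) (v : Fin s → ℤ) (i j₀ : Fin s) : ℤ :=
  |v i| - ∑ j : Fin s with j < i ∧ j ≠ j₀ ∧ 0 < v j, v j * (a i j : ℤ)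

end ModChar

end

open ModChar

/-! The key fact is the duality `⟨β, Π_ψ⟩ = δ_{βψ}` between irreducible Brauer characters and PIMs.
Let `u i k` be the multiplicity of `β k` in `φ i`, and `b' k j` that of `Π k` in `Φ j`. Duality
gives `a = u * b'`, a product of matrices over `ℕ`. Both `a` and `b'` are lower unitriangular, hence
so is `u`, and therefore `b' i j ≤ a i j`.

For (a), the multiplicity `∑ v_j b'_{ij}` of `Π i` in `Φ` is non-negative. Terms with `j > i`
vanish, the term `j = i` is `v_i`, and terms with `v_j ≤ 0` may be dropped; bounding the remaining
`b'_{ij}` with `j ≠ j₀` by `a_{ij}` leaves a lower bound for `v_{j₀} b'_{i j₀}`. For (b), only the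
multiplicities of `Π k` with `k ≥ i` are affected: at `k = i` the loss `z` is covered by `Φ j₀`, and
at `k > i` the loss `z b'_{ki}` is covered by the summand `z a_{ki} Φ k`.

Duality (`charInner_pim_eq_coord`) follows by expanding a Brauer character in `Irr(G)`, restricting
to `p`-regular elements and comparing coefficients in `IBr(G)`. It rests on completeness of the
ordinary irreducible characters (`classFunction_eq_sum`), linear independence of `IBr(G)` over `ℂ`
(`linearIndependent_IBr`), and existence of decomposition numbers (`regRestrict_mem_closure`). The
last two pass between characteristic `0` and `p` by means of a valuation ring lying over `I`. -/

namespace ModChar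

/-! ### Characteristic polynomials and eigenvalues -/

section LinearAlgebra

variable {K V : Type*} [Field K] [AddCommGroup V] [Module K V] [FiniteDimensional K V]

open Module

theorem charpoly_eq_restrict_mul_mapQ (f : End K V) (W : Submodule K V) (hW : W ≤ W.comap f) :
    f.charpoly = (f.restrict hW).charpoly * (W.mapQ W f hW).charpoly := by
  let bW := Module.finBasis K W
  let bQ := Module.finBasis K (V ⧸ W)
  let b := Module.Basis.sumQuot bW bQ
  rw [← LinearMap.charpoly_toMatrix f b, ← LinearMap.charpoly_toMatrix (f.restrict hW) bW,
    ← LinearMap.charpoly_toMatrix (W.mapQ W f hW) bQ]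
  have key : LinearMap.toMatrix b b f = Matrix.fromBlocks (LinearMap.toMatrix bW bW (f.restrict hW))
      (Matrix.of fun i j => b.repr (f (b (Sum.inr j))) (Sum.inl i)) 0
      (LinearMap.toMatrix bQ bQ (W.mapQ W f hW)) := by
    ext i j
    rcases i with i | i <;> rcases j with j | j
    · simpa [LinearMap.toMatrix_apply, b, Module.Basis.sumQuot_inl] using
        Module.Basis.sumQuot_repr_inl bW bQ (f.restrict hW (bW j)) i
    · simp [LinearMap.toMatrix_apply]
    · simpa [LinearMap.toMatrix_apply, b, Module.Basis.sumQuot_inl] using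
        Module.Basis.sumQuot_repr_inr_of_mem bW bQ (f (bW j)) (hW (bW j).2) i
    · have h := Module.Basis.sumQuot_repr_inr bW bQ (f (b (Sum.inr j))) i
      rw [Submodule.mkQ_apply, ← Submodule.mapQ_apply W W f (h := hW)] at h
      simpa [LinearMap.toMatrix_apply, b, Module.Basis.sumQuot_inr] using h
  rw [key, Matrix.charpoly_fromBlocks_zero₂₁]

/-- Split off an eigenline: the characteristic polynomial factors over the line and the quotient,
and induction on the dimension treats the quotient. -/
theorem roots_charpoly_pow [IsAlgClosed K] (f : End K V) (k : ℕ) :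
    (f ^ k).charpoly.roots = f.charpoly.roots.map (· ^ k) := by
  induction hn : finrank K V using Nat.strong_induction_on generalizing V with
  | _ n ih =>
    rcases subsingleton_or_nontrivial V with hV | hV
    · have h : ∀ g : End K V, g.charpoly = 1 := fun g =>
        (LinearMap.charpoly_monic g).natDegree_eq_zero.1 (by
          rw [LinearMap.charpoly_natDegree, finrank_zero_of_subsingleton])
      simp [h]
    · obtain ⟨μ, hμ⟩ := Module.End.exists_eigenvalue f
      obtain ⟨v, hv⟩ := hμ.exists_hasEigenvector
      have hfv : f v = μ • v := hv.apply_eq_smul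
      let W := K ∙ v
      have hW : W ≤ W.comap f := by
        rw [Submodule.span_singleton_le_iff_mem, Submodule.mem_comap, hfv]
        exact W.smul_mem _ (Submodule.mem_span_singleton_self v)
      have hWk : W ≤ W.comap (f ^ k) := by
        exact W.le_comap_pow_of_le_comap hW k
      have hWdim : finrank K W = 1 := finrank_span_singleton hv.2
      have hscal : ∀ w ∈ W, f w = μ • w := by
        intro w hw
        obtain ⟨c, rfl⟩ := Submodule.mem_span_singleton.1 hw
        rw [map_smul, hfv, smul_comm]
      have hcp : ∀ (g : End K V) (hg : W ≤ W.comap g) (c : K), (∀ w ∈ W, g w = c • w) →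
          (g.restrict hg).charpoly = Polynomial.X - Polynomial.C c := by
        intro g hg c hc
        have : g.restrict hg = algebraMap K (End K W) c := by
          ext w
          simp [hc w w.2]
        let b := Module.finBasisOfFinrankEq K W hWdim
        rw [this, ← LinearMap.charpoly_toMatrix _ b]
        simp [Matrix.charpoly, Matrix.charmatrix]
      have hpow : ∀ w ∈ W, (f ^ k) w = (μ ^ k) • w := by
        intro w hw
        clear hWk ih
        induction k with
        | zero => simp
        | succ k ihk => rw [pow_succ', Module.End.mul_apply, ihk, map_smul, hscal w hw, smul_smul, pow_succ]
      have hq : W.mapQ W (f ^ k) hWk = (W.mapQ W f hW) ^ k := Submodule.mapQ_pow W hW k hWk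
      have hlt : finrank K (V ⧸ W) < n := by
        have := Submodule.finrank_quotient_add_finrank W
        omega
      have h0 : ∀ (g : End K V) (hg : W ≤ W.comap g), (g.restrict hg).charpoly * (W.mapQ W g hg).charpoly ≠ 0 :=
        fun g hg => mul_ne_zero (LinearMap.charpoly_monic _).ne_zero (LinearMap.charpoly_monic _).ne_zero
      rw [charpoly_eq_restrict_mul_mapQ _ W hWk, charpoly_eq_restrict_mul_mapQ f W hW,
        Polynomial.roots_mul (h0 _ _), Polynomial.roots_mul (h0 _ _), hq, ih _ hlt _ rfl,
        hcp f hW μ hscal, hcp _ hWk _ hpow, Polynomial.roots_X_sub_C, Polynomial.roots_X_sub_C]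
      simp

theorem pow_eq_one_of_mem_roots_charpoly [IsAlgClosed K] {f : End K V} {n : ℕ} (hf : f ^ n = 1)
    {x : K} (hx : x ∈ f.charpoly.roots) : x ^ n = 1 := by
  have h : x ^ n ∈ (f ^ n).charpoly.roots := by
    rw [roots_charpoly_pow]
    exact Multiset.mem_map_of_mem _ hx
  rw [hf] at h
  have h2 : (1 : End K V).charpoly = (Polynomial.X - 1) ^ finrank K V := by
    rw [LinearMap.charpoly_one]
  rw [h2, Polynomial.roots_pow] at h
  have h3 := Multiset.mem_of_mem_nsmul h
  rw [← Polynomial.C_1, Polynomial.roots_X_sub_C, Multiset.mem_singleton] at h3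
  exact h3

end LinearAlgebra

/-! ### Subrepresentations, quotients and equivalences -/

section Representations

variable {k G V : Type*} [Field k] [Group G] [AddCommGroup V] [Module k V]

open Module Representation

theorem isIrreducible_iff (ρ : Representation k G V) :
    ρ.IsIrreducible ↔ Nontrivial V ∧
      ∀ W : Submodule k V, (∀ g, ∀ v ∈ W, ρ g v ∈ W) → W = ⊥ ∨ W = ⊤ := by
  have hbot : (⊥ : Subrepresentation ρ).toSubmodule = ⊥ := rfl
  have htop : (⊤ : Subrepresentation ρ).toSubmodule = ⊤ := rfl
  constructor
  · intro h
    refine ⟨?_, fun W hW => ?_⟩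
    · by_contra hV
      rw [not_nontrivial_iff_subsingleton] at hV
      exact (bot_ne_top (α := Subrepresentation ρ))
        (Subrepresentation.toSubmodule_injective (Subsingleton.elim _ _))
    · refine (eq_bot_or_eq_top (⟨W, fun g v hv => hW g v hv⟩ : Subrepresentation ρ)).imp ?_ ?_
      · exact fun h => congrArg Subrepresentation.toSubmodule h
      · exact fun h => congrArg Subrepresentation.toSubmodule h
  · rintro ⟨hV, h⟩
    refine { exists_pair_ne := ⟨⊥, ⊤, fun h => bot_ne_top (α := Submodule k V)
      (congrArg Subrepresentation.toSubmodule h)⟩, eq_bot_or_eq_top := fun S => ?_ }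
    exact (h S.toSubmodule S.apply_mem_toSubmodule).imp
      (fun h => Subrepresentation.toSubmodule_injective h)
      (fun h => Subrepresentation.toSubmodule_injective h)

theorem exists_equiv_fin [FiniteDimensional k V] (ρ : Representation k G V) :
    ∃ (n : ℕ) (X : Representation k G (Fin n → k)), Nonempty (ρ.Equiv X) := by
  let e : V ≃ₗ[k] (Fin (finrank k V) → k) := (finBasis k V).equivFun
  refine ⟨finrank k V, ⟨⟨fun g => e.conj (ρ g), ?_⟩, ?_⟩, ⟨Representation.Equiv.mk e ?_⟩⟩
  · rw [map_one]
    exact e.conj_id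
  · intro g h
    change e.conj (ρ (g * h)) = e.conj (ρ g) ∘ₗ e.conj (ρ h)
    rw [map_mul]
    exact e.conj_comp _ _
  · intro g
    ext v
    simp [LinearEquiv.conj_apply]

theorem IsIrreducible.of_equiv {W : Type*} [AddCommGroup W] [Module k W] {ρ : Representation k G V}
    {σ : Representation k G W} (e : ρ.Equiv σ) (h : ρ.IsIrreducible) : σ.IsIrreducible := by
  rw [isIrreducible_iff] at h ⊢
  obtain ⟨hV, h⟩ := h
  refine ⟨e.toLinearEquiv.symm.toEquiv.nontrivial, fun U hU => ?_⟩
  have key := h (U.comap e.toLinearEquiv.toLinearMap) fun g v hv => by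
    have h1 := hU g _ hv
    have h2 : e.toLinearEquiv (ρ g v) = σ g (e.toLinearEquiv v) :=
      IntertwiningMap.isIntertwining ρ σ e.toIntertwiningMap g v
    rw [Submodule.mem_comap]
    exact h2.symm ▸ h1
  have hmap : U = (U.comap e.toLinearEquiv.toLinearMap).map e.toLinearEquiv.toLinearMap :=
    (Submodule.map_comap_eq_of_surjective e.toLinearEquiv.surjective U).symm
  refine key.imp (fun h => ?_) (fun h => ?_)
  · rw [hmap, h, Submodule.map_bot]
  · rw [hmap, h, Submodule.map_top, LinearEquiv.range]

theorem charpoly_eq_of_equiv [FiniteDimensional k V] {W : Type*} [AddCommGroup W] [Module k W]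
    [FiniteDimensional k W] {ρ : Representation k G V}
    {σ : Representation k G W} (e : ρ.Equiv σ) (g : G) : (ρ g).charpoly = (σ g).charpoly := by
  rw [← e.conj_apply_self g]
  exact (LinearEquiv.charpoly_conj _ _).symm

/-- The restriction of a representation to an invariant subspace. -/
def subRep (ρ : Representation k G V) (W : Submodule k V) (hW : ∀ g, ∀ v ∈ W, ρ g v ∈ W) :
    Representation k G W where
  toFun g := (ρ g).restrict (hW g)
  map_one' := by ext; simp
  map_mul' x y := by ext; simp

/-- The representation on the quotient by an invariant subspace. -/
def quotRep (ρ : Representation k G V) (W : Submodule k V) (hW : ∀ g, ∀ v ∈ W, ρ g v ∈ W) :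
    Representation k G (V ⧸ W) where
  toFun g := W.mapQ W (ρ g) (hW g)
  map_one' := by ext; simp
  map_mul' x y := by ext; simp

theorem charpoly_eq_subRep_mul_quotRep [FiniteDimensional k V] (ρ : Representation k G V)
    (W : Submodule k V) (hW : ∀ g, ∀ v ∈ W, ρ g v ∈ W) (g : G) :
    (ρ g).charpoly = (subRep ρ W hW g).charpoly * (quotRep ρ W hW g).charpoly :=
  charpoly_eq_restrict_mul_mapQ (ρ g) W (hW g)

end Representations

/-! ### Ordinary characters: completeness and orthogonality -/

section Ordinary

variable {k G : Type*} [Field k] [IsAlgClosed k] [CharZero k] [Group G] [Fintype G]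

open Module Representation

/-- As `f` is a class function, the operator is an intertwiner, hence a scalar by Schur. Its trace
is zero and the dimension is invertible in characteristic zero. -/
theorem sum_smul_eq_zero_of_isIrreducible {V : Type*} [AddCommGroup V] [Module k V]
    [FiniteDimensional k V] {f : G → k} (hf : ∀ g h, f (h * g * h⁻¹) = f g)
    (ρ : Representation k G V) [ρ.IsIrreducible] (horth : ∑ g, f g * ρ.character g⁻¹ = 0) :
    ∑ g, f g • ρ g⁻¹ = 0 := by
  let T : ρ.IntertwiningMap ρ := LinearMap.intertwiningMap_of_isIntertwiningMap ρ ρ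
    (∑ g, f g • ρ g⁻¹) fun h v => by
      simp only [LinearMap.sum_apply, LinearMap.smul_apply, map_sum, map_smul,
        ← Module.End.mul_apply, ← map_mul]
      refine Fintype.sum_equiv (MulAut.conj h⁻¹).toEquiv _ _ fun g => ?_
      have h1 : f (h⁻¹ * g * h) = f g := by simpa using hf g h⁻¹
      simp only [MulEquiv.toEquiv_eq_coe, EquivLike.coe_coe, MulAut.conj_apply, inv_inv, h1]
      simp [mul_assoc]
  obtain ⟨c, hc⟩ := (IsIrreducible.algebraMap_intertwiningMap_bijective_of_isAlgClosed (ρ := ρ)).2 T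
  have hT : (∑ g, f g • ρ g⁻¹) = c • (1 : End k V) := by
    have := congrArg IntertwiningMap.toLinearMap hc
    rw [Algebra.algebraMap_eq_smul_one] at this
    exact this.symm
  have htr := congrArg (LinearMap.trace k V) hT
  simp only [map_sum, map_smul, LinearMap.trace_one, smul_eq_mul] at htr
  have h0 : c * (finrank k V : k) = 0 := htr.symm.trans horth
  have hV := ((isIrreducible_iff ρ).1 inferInstance).1
  have hpos : (finrank k V : k) ≠ 0 := by exact_mod_cast (finrank_pos (R := k) (M := V)).ne'
  rw [hT, (mul_eq_zero.1 h0).resolve_right hpos, zero_smul]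

theorem sum_smul_eq_zero {V : Type*} [AddCommGroup V] [Module k V]
    [FiniteDimensional k V] {f : G → k} (hf : ∀ g h, f (h * g * h⁻¹) = f g)
    (horth : ∀ (n : ℕ) (X : Representation k G (Fin n → k)), X.IsIrreducible →
      ∑ g, f g * X.character g⁻¹ = 0)
    (ρ : Representation k G V) :
    ∑ g, f g • ρ g⁻¹ = 0 := by
  induction hn : finrank k V using Nat.strong_induction_on generalizing V with
  | _ n ih =>
    by_cases hirr : ρ.IsIrreducible
    · obtain ⟨m, X, ⟨e⟩⟩ := exists_equiv_fin ρ
      refine sum_smul_eq_zero_of_isIrreducible hf ρ ?_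
      simp only [char_iso e]
      exact horth m X (IsIrreducible.of_equiv e hirr)
    rcases subsingleton_or_nontrivial V with hV | hV
    · exact Subsingleton.elim _ _
    have h := mt (isIrreducible_iff ρ).2 hirr
    push Not at h
    obtain ⟨W, hW, hbot, htop⟩ := h hV
    -- Maschke: an invariant complement exists, and the operator vanishes on both summands by
    -- induction.
    have hss : IsSemisimpleRepresentation ρ := inferInstance
    obtain ⟨S, hS⟩ := exists_isCompl (⟨W, fun g v hv => hW g v hv⟩ : Subrepresentation ρ)
    have hsup : W ⊔ S.toSubmodule = ⊤ :=
      congrArg Subrepresentation.toSubmodule hS.sup_eq_top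
    have hinf : W ⊓ S.toSubmodule = ⊥ :=
      congrArg Subrepresentation.toSubmodule hS.inf_eq_bot
    have hStop : S.toSubmodule ≠ ⊤ := by
      intro h
      rw [h, inf_top_eq] at hinf
      exact hbot hinf
    have hzero : ∀ (U : Submodule k V) (hU : ∀ g, ∀ v ∈ U, ρ g v ∈ U), U ≠ ⊤ →
        ∀ v ∈ U, (∑ g, f g • ρ g⁻¹) v = 0 := by
      intro U hU hne v hv
      have := ih (finrank k U) (hn ▸ Submodule.finrank_lt hne) (subRep ρ U hU) rfl
      have h2 := congrArg Subtype.val (LinearMap.congr_fun this ⟨v, hv⟩)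
      simpa [subRep, LinearMap.sum_apply] using h2
    ext v
    obtain ⟨a, ha, b, hb, rfl⟩ := Submodule.mem_sup.1 (hsup ▸ Submodule.mem_top : v ∈ W ⊔ S.toSubmodule)
    rw [map_add, hzero W hW htop a ha, hzero _ S.apply_mem_toSubmodule hStop b hb]
    simp

omit [IsAlgClosed k] [CharZero k] [Fintype G] in
variable (k G) in
/-- The left regular representation on functions. -/
def funRep : Representation k G (G → k) where
  toFun g := LinearMap.funLeft k k (g⁻¹ * ·)
  map_one' := by ext; simp [LinearMap.funLeft]
  map_mul' x y := by ext; simp [LinearMap.funLeft, mul_assoc]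

theorem classFunction_eq_zero {f : G → k} (hf : ∀ g h, f (h * g * h⁻¹) = f g)
    (horth : ∀ (n : ℕ) (X : Representation k G (Fin n → k)), X.IsIrreducible →
      ∑ g, f g * X.character g⁻¹ = 0) : f = 0 := by
  classical
  have h := sum_smul_eq_zero hf horth (funRep k G)
  ext x
  -- In the regular representation the operator sends the delta function at `1` to `∑ f(g) δ_{g⁻¹}`,
  -- whose value at `x⁻¹` is `f x`.
  have h2 := congrFun (LinearMap.congr_fun h (Pi.single 1 1)) x⁻¹
  simpa [funRep, LinearMap.funLeft_apply, LinearMap.sum_apply, Pi.single_apply, mul_inv_eq_one,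
    Finset.sum_ite_eq] using h2

variable (k G) in
/-- The set of irreducible characters over `k`. -/
def irrChars : Set (G → k) :=
  {χ | ∃ (n : ℕ) (X : Representation k G (Fin n → k)), X.IsIrreducible ∧ χ = X.character}

open Classical in
theorem irrChars_orthonormal {χ ψ : G → k} (hχ : χ ∈ irrChars k G) (hψ : ψ ∈ irrChars k G) :
    (Nat.card G : k)⁻¹ * ∑ g, χ g * ψ g⁻¹ = if χ = ψ then 1 else 0 := by
  obtain ⟨n, X, hX, rfl⟩ := hχ
  obtain ⟨m, Y, hY, rfl⟩ := hψ
  have : Invertible (Nat.card G : k) := invertibleOfNonzero (by exact_mod_cast Nat.card_pos.ne')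
  have h := char_orthonormal X Y
  split_ifs with heq
  · have h1 := char_orthonormal X X
    rw [if_pos ⟨Representation.Equiv.refl X⟩] at h1
    rw [← heq]
    exact h1
  · rw [h, if_neg]
    rintro ⟨e⟩
    exact heq (char_iso e).symm

theorem irrChars_finite : (irrChars k G).Finite := by
  have hli : LinearIndependent k (Subtype.val : irrChars k G → G → k) := by
    classical
    rw [linearIndependent_iff']
    intro s c hc χ hχ
    have h : (Nat.card G : k)⁻¹ * ∑ g, (∑ ψ ∈ s, c ψ • ψ.1) g * χ.1 g⁻¹ = c χ := by
      simp only [Finset.sum_apply, Pi.smul_apply, smul_eq_mul, Finset.sum_mul]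
      rw [Finset.sum_comm, Finset.mul_sum]
      calc _ = ∑ ψ ∈ s, c ψ * ((Nat.card G : k)⁻¹ * ∑ g, ψ.1 g * χ.1 g⁻¹) := by
            simp only [Finset.mul_sum]
            refine Finset.sum_congr rfl fun _ _ => Finset.sum_congr rfl fun _ _ => by ring
        _ = ∑ ψ ∈ s, if ψ = χ then c ψ else 0 := by
            refine Finset.sum_congr rfl fun ψ _ => ?_
            rw [irrChars_orthonormal ψ.2 χ.2]
            simp [Subtype.ext_iff]
        _ = c χ := by simp [hχ]
    rw [← h, hc]
    simp
  exact hli.setFinite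

theorem classFunction_eq_sum {f : G → k} (hf : ∀ g h, f (h * g * h⁻¹) = f g) :
    f = ∑ χ ∈ irrChars_finite.toFinset, ((Nat.card G : k)⁻¹ * ∑ g, f g * χ g⁻¹) • χ := by
  classical
  rw [← sub_eq_zero]
  refine classFunction_eq_zero (fun g h => ?_) fun n X hX => ?_
  · simp only [Pi.sub_apply, hf, Finset.sum_apply, Pi.smul_apply]
    congr 1
    refine Finset.sum_congr rfl fun χ hχ => ?_
    obtain ⟨n, X, hX, rfl⟩ := irrChars_finite.mem_toFinset.1 hχ
    simp
  · have hXm : X.character ∈ irrChars k G := ⟨n, X, hX, rfl⟩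
    have h : ∑ g, (∑ χ ∈ irrChars_finite.toFinset,
        ((Nat.card G : k)⁻¹ * ∑ g, f g * χ g⁻¹) • χ) g * X.character g⁻¹
        = ∑ g, f g * X.character g⁻¹ := by
      simp only [Finset.sum_apply, Pi.smul_apply, smul_eq_mul, Finset.sum_mul]
      rw [Finset.sum_comm]
      calc _ = ∑ χ ∈ irrChars_finite.toFinset, (∑ g, f g * χ g⁻¹) *
            ((Nat.card G : k)⁻¹ * ∑ g, χ g * X.character g⁻¹) := by
            refine Finset.sum_congr rfl fun χ _ => ?_
            generalize ∑ g, f g * χ g⁻¹ = d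
            simp only [Finset.mul_sum]
            refine Finset.sum_congr rfl fun _ _ => by ring
        _ = ∑ χ ∈ irrChars_finite.toFinset, if χ = X.character then ∑ g, f g * χ g⁻¹ else 0 := by
            refine Finset.sum_congr rfl fun χ hχ => ?_
            rw [irrChars_orthonormal (irrChars_finite.mem_toFinset.1 hχ) hXm]
            simp
        _ = _ := by simp [hXm]
    simp only [Pi.sub_apply, sub_mul, Finset.sum_sub_distrib, h, sub_self]

end Ordinary

/-! ### Separating irreducible representations by the density theorem -/

section Density

open Module Representation
open scoped MonoidAlgebra

variable {F G : Type*} [Field F] [IsAlgClosed F] [Group G]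
  {ι : Type*} [Fintype ι] [DecidableEq ι] {n : ι → ℕ}
  (X : ∀ i, Representation F G (Fin (n i) → F))

/-- Schur's lemma blockwise: off-diagonal components vanish by inequivalence, diagonal ones are
scalars. -/
theorem end_pi_apply (hirr : ∀ i, (X i).IsIrreducible)
    (hne : ∀ i j, i ≠ j → IsEmpty ((X i).Equiv (X j)))
    (h : End F[G] (∀ i, (X i).asModule)) (i : ι) :
    ∃ c : F, ∀ y, h y i = c • y i := by
  let comp : ∀ j, (X j).asModule →ₗ[F[G]] (X i).asModule := fun j =>
    LinearMap.proj i ∘ₗ h ∘ₗ LinearMap.single F[G] (fun i => (X i).asModule) j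
  have hsum : ∀ y, h y i = ∑ j, comp j (y j) := by
    intro y
    conv_lhs => rw [← Finset.univ_sum_single y]
    simp [comp]
  have hzero : ∀ j, j ≠ i → comp j = 0 := by
    intro j hj
    have := hne j i hj
    have := hirr i
    have := hirr j
    have hs : (IntertwiningMap.equivLinearMapAsModule (X j) (X i)).symm (comp j) = 0 :=
      Subsingleton.elim _ _
    simpa using hs
  have := hirr i
  obtain ⟨c, hc⟩ := (IsIrreducible.algebraMap_intertwiningMap_bijective_of_isAlgClosed
    (ρ := X i)).2 ((IntertwiningMap.equivLinearMapAsModule (X i) (X i)).symm (comp i))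
  have hci : ∀ v, comp i v = c • v := by
    intro v
    have h1 : ((IntertwiningMap.equivLinearMapAsModule (X i) (X i)).symm (comp i)).toLinearMap v
      = comp i v := rfl
    rw [← h1, ← hc, Algebra.algebraMap_eq_smul_one]
    rfl
  refine ⟨c, fun y => ?_⟩
  rw [hsum, Finset.sum_eq_single i (fun j _ hj => by rw [hzero j hj]; rfl) (by simp), hci]

theorem exists_asAlgebraHom_eq (hirr : ∀ i, (X i).IsIrreducible)
    (hne : ∀ i j, i ≠ j → IsEmpty ((X i).Equiv (X j))) (i₀ : ι)
    (E : End F (Fin (n i₀) → F)) :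
    ∃ r : F[G], (X i₀).asAlgebraHom r = E ∧ ∀ i, i ≠ i₀ → (X i).asAlgebraHom r = 0 := by
  classical
  have hs : ∀ i, IsSimpleModule F[G] (X i).asModule := fun i =>
    (irreducible_iff_isSimpleModule_asModule _).1 (hirr i)
  let M := ∀ i, (X i).asModule
  let E' : (X i₀).asModule →ₗ[F] (X i₀).asModule := (X i₀).asModuleEquiv.symm.conj E
  let e : M →ₗ[F] M :=
    LinearMap.single F (fun i => (X i).asModule) i₀ ∘ₗ E' ∘ₗ LinearMap.proj i₀
  have he : ∀ x, e x = Pi.single i₀ (E' (x i₀)) := fun x => rfl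
  -- Acting by `E` on one factor and by `0` on the others commutes with every `F[G]`-endomorphism,
  -- since these are scalar on each factor; so the density theorem applies.
  let f : End (End F[G] M) M :=
    { toFun := e
      map_add' := e.map_add
      map_smul' := fun h x => by
        ext1 i
        obtain ⟨c, hc⟩ := end_pi_apply X hirr hne h i
        change e (h x) i = h (e x) i
        rw [hc, he, he]
        by_cases hi : i = i₀
        · subst hi
          rw [Pi.single_eq_same, Pi.single_eq_same, hc, map_smul]
        · rw [Pi.single_eq_of_ne hi, Pi.single_eq_of_ne hi, smul_zero] }
  let b : ∀ i, Fin (n i) → (X i).asModule := fun i j => (X i).asModuleEquiv.symm (Pi.single j 1)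
  let s : Finset M := Finset.univ.image fun x : Σ i, Fin (n i) => Pi.single x.1 (b x.1 x.2)
  obtain ⟨r, hr⟩ := jacobson_density f s
  have key : ∀ i (j : Fin (n i)), (X i).asAlgebraHom r (Pi.single j 1)
      = (X i).asModuleEquiv (e (Pi.single i (b i j)) i) := by
    intro i j
    have h : e (Pi.single i (b i j)) i = (r • (Pi.single i (b i j) : M)) i :=
      congrFun (hr _ (Finset.mem_image.2 ⟨⟨i, j⟩, Finset.mem_univ _, rfl⟩)) i
    rw [h, Pi.smul_apply, Pi.single_eq_same, asModuleEquiv_map_smul, LinearEquiv.apply_symm_apply]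
  refine ⟨r, (Pi.basisFun F _).ext fun j => ?_, fun i hi => (Pi.basisFun F _).ext fun j => ?_⟩
  · rw [Pi.basisFun_apply, key, he, Pi.single_eq_same, Pi.single_eq_same]
    simp [E', b, LinearEquiv.conj_apply]
  · rw [Pi.basisFun_apply, key, he, Pi.single_eq_of_ne hi]
    rfl

/-- Take traces of a group algebra element acting as a rank-one matrix unit on `X i₀` and as zero
elsewhere. A matrix unit has trace `1` in any characteristic, whereas the identity could have trace
`0`. -/
theorem exists_sum_character_eq [Fintype G] (hirr : ∀ i, (X i).IsIrreducible)
    (hne : ∀ i j, i ≠ j → IsEmpty ((X i).Equiv (X j))) (i₀ : ι) :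
    ∃ e : G → F, ∀ i, ∑ g, e g * (X i).character g = if i = i₀ then 1 else 0 := by
  have hn := ((isIrreducible_iff _).1 (hirr i₀)).1
  have hpos : 0 < n i₀ := by
    by_contra h0
    have : IsEmpty (Fin (n i₀)) := by
      rw [Nat.eq_zero_of_not_pos h0]
      infer_instance
    exact not_subsingleton (Fin (n i₀) → F) inferInstance
  let j₀ : Fin (n i₀) := ⟨0, hpos⟩
  obtain ⟨r, hr, hr'⟩ := exists_asAlgebraHom_eq X hirr hne i₀
    (Matrix.toLin' (Matrix.single j₀ j₀ 1))
  refine ⟨fun g => r.coeff g, fun i => ?_⟩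
  have h : ∑ g, r.coeff g * (X i).character g = LinearMap.trace F _ ((X i).asAlgebraHom r) := by
    rw [asAlgebraHom_def, MonoidAlgebra.lift_apply, Finsupp.sum_fintype _ _ (by simp), map_sum]
    simp [character]
  rw [h]
  split_ifs with hi
  · subst hi
    rw [hr, Matrix.trace_toLin'_eq]
    simp [Matrix.trace_single_eq_same]
  · rw [hr' i hi, map_zero]

end Density

/-! ### The residue field, lifting of roots of unity, valuation rings over `I` -/

section ResidueField

variable {p : ℕ} [hp : Fact p.Prime] {I : Ideal AlgInt} [I.IsMaximal] (hI : (p : AlgInt) ∈ I)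

include hp hI in
theorem charP_residue : CharP (Residue I) p := by
  refine ringChar.of_eq (CharP.ringChar_of_prime_eq_zero hp.out ?_)
  rw [← map_natCast (Ideal.Quotient.mk I)]
  exact Ideal.Quotient.eq_zero_iff_mem.2 hI

/-- A monic polynomial over `F` lifts to a monic one over `R`; its complex roots are again algebraic
integers and can be reduced. -/
instance isAlgClosed_residue : IsAlgClosed (Residue I) := by
  refine IsAlgClosed.of_exists_root _ fun f hf hirr => ?_
  obtain ⟨q, hq, hdeg, hmon⟩ := Polynomial.lifts_and_natDegree_eq_and_monic
    (f := Ideal.Quotient.mk I) (p := f) (Polynomial.map_surjective _ Ideal.Quotient.mk_surjective f) hf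
  have hd : (q.map (algebraMap AlgInt ℂ)).degree ≠ 0 := by
    rw [hmon.degree_map]
    have := hirr.natDegree_pos
    rw [Polynomial.degree_eq_natDegree hmon.ne_zero]
    exact_mod_cast (hdeg ▸ this).ne'
  obtain ⟨z, hz⟩ := IsAlgClosed.exists_root _ hd
  have hz' : Polynomial.eval₂ (algebraMap AlgInt ℂ) z q = 0 := by
    rwa [Polynomial.IsRoot, Polynomial.eval_map] at hz
  have hint : IsIntegral ℤ z := isIntegral_trans (R := ℤ) (A := AlgInt) z ⟨q, hmon, hz'⟩
  refine ⟨Ideal.Quotient.mk I ⟨z, hint⟩, ?_⟩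
  rw [← hq, Polynomial.eval_map, Polynomial.eval₂_hom]
  have : q.eval (⟨z, hint⟩ : AlgInt) = 0 := by
    apply Subtype.val_injective
    have h := Polynomial.hom_eval₂ q (RingHom.id AlgInt) (algebraMap AlgInt ℂ) ⟨z, hint⟩
    rw [RingHom.comp_id] at h
    exact h.trans hz'
  rw [this, map_zero]

theorem exists_pow_eq_one_mk_eq {m : ℕ} (hm : m ≠ 0) {x : Residue I} (hx : x ^ m = 1) :
    ∃ r : AlgInt, r ^ m = 1 ∧ Ideal.Quotient.mk I r = x := by
  obtain ⟨ζ, hζ⟩ : ∃ ζ : ℂ, IsPrimitiveRoot ζ m := ⟨_, Complex.isPrimitiveRoot_exp m hm⟩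
  have hint : IsIntegral ℤ ζ := hζ.isIntegral (Nat.pos_of_ne_zero hm)
  have hζ' : IsPrimitiveRoot (⟨ζ, hint⟩ : AlgInt) m :=
    IsPrimitiveRoot.of_map_of_injective (f := algebraMap AlgInt ℂ) hζ Subtype.val_injective
  have h := congrArg (Polynomial.eval₂ (Ideal.Quotient.mk I) x)
    (Polynomial.X_pow_sub_one_eq_prod (Nat.pos_of_ne_zero hm) hζ')
  rw [Polynomial.eval₂_finsetProd] at h
  simp only [Polynomial.eval₂_sub, Polynomial.eval₂_pow, Polynomial.eval₂_X, Polynomial.eval₂_one,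
    Polynomial.eval₂_C, hx, sub_self] at h
  obtain ⟨r, hr, hr0⟩ := Finset.prod_eq_zero_iff.1 h.symm
  exact ⟨r, (Polynomial.mem_nthRootsFinset (Nat.pos_of_ne_zero hm) _).1 hr, (sub_eq_zero.1 hr0).symm⟩

include hp hI in
theorem eq_of_mk_eq_of_pow_eq_one {m : ℕ} (hm : ¬ p ∣ m) {r t : AlgInt} (hr : r ^ m = 1)
    (ht : t ^ m = 1) (h : Ideal.Quotient.mk I r = Ideal.Quotient.mk I t) : r = t := by
  have hm0 : m ≠ 0 := fun h => hm (h ▸ dvd_zero p)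
  obtain ⟨n, rfl⟩ := Nat.exists_eq_succ_of_ne_zero hm0
  have := charP_residue hI
  -- With `m = n + 1`, `t ^ n` is the inverse of `t`, so `u = r / t`. If `u ≠ 1`, the geometric sum
  -- of its powers is `0`, but it reduces to `m`, which is nonzero in `F`.
  set u := r * t ^ n with hu
  have hun : u ^ (n + 1) = 1 := by
    rw [hu, mul_pow, hr, ← pow_mul, mul_comm n, pow_mul, ht, one_pow, one_mul]
  have huk : Ideal.Quotient.mk I u = 1 := by
    rw [hu, map_mul, h, ← map_mul, ← pow_succ', ht, map_one]
  have hu1 : u = 1 := by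
    by_contra hne
    have hs : ∑ i ∈ Finset.range (n + 1), u ^ i = 0 := by
      have := geom_sum_mul u (n + 1)
      rw [hun, sub_self] at this
      exact (mul_eq_zero.1 this).resolve_right (sub_ne_zero.2 hne)
    have h2 := congrArg (Ideal.Quotient.mk I) hs
    simp only [map_sum, map_pow, huk, one_pow, map_zero, Finset.sum_const, Finset.card_range,
      nsmul_eq_mul, mul_one] at h2
    exact hm ((CharP.cast_eq_zero_iff (Residue I) p _).1 h2)
  calc r = r * t ^ (n + 1) := by rw [ht, mul_one]
    _ = u * t := by rw [hu, pow_succ, mul_assoc]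
    _ = t := by rw [hu1, one_mul]

theorem liftRoot_spec {m : ℕ} (hm : m ≠ 0) {x : Residue I} (hx : x ^ m = 1) :
    ∃ r : AlgInt, r ^ m = 1 ∧ Ideal.Quotient.mk I r = x ∧ liftRoot I m x = r := by
  have h : ∃ r ∈ {r : AlgInt | r ^ m = 1}, Ideal.Quotient.mk I r = x :=
    exists_pow_eq_one_mk_eq hm hx
  exact ⟨_, Function.invFunOn_mem h, Function.invFunOn_eq h, rfl⟩

include hp hI in
theorem liftRoot_mk {m : ℕ} (hm : ¬ p ∣ m) {r : AlgInt} (hr : r ^ m = 1) :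
    liftRoot I m (Ideal.Quotient.mk I r) = r := by
  have hm0 : m ≠ 0 := fun h => hm (h ▸ dvd_zero p)
  obtain ⟨t, ht, htr, h⟩ := liftRoot_spec (I := I) (x := Ideal.Quotient.mk I r) hm0
    (by rw [← map_pow, hr, map_one])
  rw [h, eq_of_mk_eq_of_pow_eq_one hI hm ht hr htr]

/-- A proper ideal of a subring of a field is contained in the nonunits of some valuation ring
containing the subring. This is needed in `ℂ` for linear independence and in `AlgNum` for reduction
of representations. -/
theorem exists_valuationSubring (I : Ideal AlgInt) [I.IsMaximal] {L : Type*} [Field L]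
    (j₀ : AlgInt →+* L) (hj₀ : Function.Injective j₀) :
    ∃ (V : ValuationSubring L) (j : AlgInt →+* V), (∀ r, (j r : L) = j₀ r) ∧
      ∀ r ∈ I, IsLocalRing.residue V (j r) = 0 := by
  let e : AlgInt ≃+* j₀.range := RingEquiv.ofBijective j₀.rangeRestrict
    ⟨fun a b h => hj₀ (congrArg Subtype.val h), j₀.rangeRestrict_surjective⟩
  have hne : I.comap e.symm.toRingHom ≠ ⊤ := by
    intro h
    refine (inferInstance : I.IsMaximal).ne_top ((Ideal.eq_top_iff_one I).2 ?_)
    have := (Ideal.eq_top_iff_one _).1 h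
    simpa using this
  obtain ⟨V, hV, hIV⟩ := Ideal.image_subset_nonunits_valuationSubring (A := j₀.range) _ hne
  refine ⟨V, j₀.codRestrict V.toSubring fun r => hV ⟨r, rfl⟩, fun r => rfl, fun r hr => ?_⟩
  rw [IsLocalRing.residue_eq_zero_iff]
  have h : j₀ r ∈ V.nonunits := hIV ⟨e r, by simpa using hr, rfl⟩
  rw [← SetLike.mem_coe, ← ValuationSubring.image_maximalIdeal] at h
  obtain ⟨v, hv, hvr⟩ := h
  convert! hv
  exact Subtype.ext hvr.symm

/-- The inclusion of the algebraic integers into the algebraic numbers. -/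
noncomputable def algIntToAlgNum : AlgInt →+* AlgNum :=
  (algebraMap AlgInt ℂ).codRestrict (algebraicClosure ℚ ℂ).toSubring fun r =>
    (mem_algebraicClosure_iff (F := ℚ) (E := ℂ)).2 (r.2.tower_top (A := ℚ)).isAlgebraic

theorem coe_algIntToAlgNum (r : AlgInt) : ((algIntToAlgNum r : AlgNum) : ℂ) = r := rfl

include hp hI in
-- Over the algebraic numbers the residue field of `V` is no larger than `F`, so reduction modulo
-- its maximal ideal yields representations over `F` itself.
theorem exists_reduction : ∃ (V : ValuationSubring AlgNum) (j : AlgInt →+* V)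
    (θ : V →+* Residue I), (∀ r, ((j r : AlgNum) : ℂ) = r) ∧ ∀ r, θ (j r) = Ideal.Quotient.mk I r := by
  obtain ⟨V, j, hj, hjI⟩ := exists_valuationSubring I algIntToAlgNum
    (fun a b h => Subtype.ext (congrArg (algebraMap AlgNum ℂ) h))
  let ι : Residue I →+* IsLocalRing.ResidueField V :=
    Ideal.Quotient.lift I ((IsLocalRing.residue V).comp j) hjI
  have hι : ∀ r, ι (Ideal.Quotient.mk I r) = IsLocalRing.residue V (j r) := fun r => rfl
  have := charP_residue hI
  have hsurj : Function.Surjective ι := by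
    intro y
    obtain ⟨v, rfl⟩ := IsLocalRing.residue_surjective y
    have : Algebra.IsAlgebraic ℚ AlgNum := algebraicClosure.isAlgebraic ℚ ℂ
    have halg : IsAlgebraic ℤ (v : AlgNum) :=
      (IsFractionRing.isAlgebraic_iff ℤ ℚ AlgNum).2 (Algebra.IsAlgebraic.isAlgebraic (v : AlgNum))
    obtain ⟨P, hP, hPv⟩ := halg
    have hQv : Polynomial.aeval (v : AlgNum) P.primPart = 0 :=
      Polynomial.aeval_primPart_eq_zero hP hPv
    have hQprim := P.isPrimitive_primPart
    set Q := P.primPart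
    -- A primitive integer polynomial is not divisible by `p`, so it stays nonzero over `F`. It
    -- splits there, which forces the residue of its root `v` into the image of `F`.
    have hQF : Q.map (Int.castRingHom (Residue I)) ≠ 0 := by
      intro h0
      have hdvd : Polynomial.C (p : ℤ) ∣ Q := by
        rw [Polynomial.C_dvd_iff_dvd_coeff]
        intro i
        have := congrArg (Polynomial.coeff · i) h0
        simpa [Polynomial.coeff_map, CharP.intCast_eq_zero_iff (Residue I) p] using this
      have := hQprim _ hdvd
      have h2 := Int.isUnit_iff.1 this
      have := hp.out.one_lt
      omega
    have hQv' : Polynomial.eval₂ (Int.castRingHom V) v Q = 0 := by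
      apply Subtype.val_injective
      have h := Polynomial.hom_eval₂ Q (Int.castRingHom V) V.subtype v
      rw [RingHom.eq_intCast' (V.subtype.comp _)] at h
      refine h.trans ?_
      rw [Polynomial.aeval_def] at hQv
      exact hQv
    have hQy : (Q.map (Int.castRingHom (Residue I))).eval₂ ι (IsLocalRing.residue V v) = 0 := by
      rw [Polynomial.eval₂_map, RingHom.eq_intCast' (ι.comp _),
        ← RingHom.eq_intCast' ((IsLocalRing.residue V).comp (Int.castRingHom V)),
        ← Polynomial.hom_eval₂, hQv', map_zero]
    have hspl := IsAlgClosed.splits (Q.map (Int.castRingHom (Residue I)))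
    rw [hspl.eq_prod_roots, Polynomial.eval₂_mul, Polynomial.eval₂_C, Polynomial.eval₂_multiset_prod] at hQy
    have hl : ι (Q.map (Int.castRingHom (Residue I))).leadingCoeff ≠ 0 := by
      rw [map_ne_zero]
      exact Polynomial.leadingCoeff_ne_zero.2 hQF
    have h := Multiset.prod_eq_zero_iff.1 ((mul_eq_zero.1 hQy).resolve_left hl)
    simp only [Multiset.map_map, Multiset.mem_map, Function.comp] at h
    obtain ⟨a, -, ha⟩ := h
    rw [Polynomial.eval₂_sub, Polynomial.eval₂_X, Polynomial.eval₂_C] at ha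
    exact ⟨a, (sub_eq_zero.1 ha).symm⟩
  let e : Residue I ≃+* IsLocalRing.ResidueField V := RingEquiv.ofBijective ι ⟨ι.injective, hsurj⟩
  refine ⟨V, j, e.symm.toRingHom.comp (IsLocalRing.residue V), fun r => ?_, fun r => ?_⟩
  · rw [hj, coe_algIntToAlgNum]
  · change e.symm (IsLocalRing.residue V (j r)) = _
    rw [← hι]
    exact e.symm_apply_eq.2 rfl

end ResidueField

/-! ### Brauer characters and their linear independence -/

section BrauerCharacters

open Module Representation

variable {p : ℕ} [hp : Fact p.Prime] {I : Ideal AlgInt} [I.IsMaximal] (hI : (p : AlgInt) ∈ I)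
  {G : Type*} [Group G] [Fintype G]

theorem mem_addSubmonoid_closure_iff {M : Type*} [AddCommMonoid M] {S : Set M} {x : M} :
    x ∈ AddSubmonoid.closure S ↔
      ∃ d : M →₀ ℕ, (d.support : Set M) ⊆ S ∧ x = d.sum fun y k => k • y := by
  rw [← Submodule.span_nat_eq_addSubmonoidClosure, Submodule.mem_toAddSubmonoid,
    Submodule.mem_span_set]
  simp only [eq_comm]

omit [Fintype G] in
include hp in
theorem orderOf_dvd_ordCompl {g : G} (hg : ¬ p ∣ orderOf g) :
    orderOf g ∣ ordCompl[p] (Nat.card G) := by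
  have h : orderOf g ∣ ordProj[p] (Nat.card G) * ordCompl[p] (Nat.card G) := by
    rw [Nat.ordProj_mul_ordCompl_eq_self]
    exact orderOf_dvd_natCard g
  exact (Nat.Coprime.pow_right _ ((Nat.Prime.coprime_iff_not_dvd hp.out).2 hg).symm).dvd_of_dvd_mul_left h

include hp in
variable (p G) in
theorem not_dvd_ordCompl_card : ¬ p ∣ ordCompl[p] (Nat.card G) :=
  Nat.not_dvd_ordCompl hp.out Nat.card_pos.ne'

include hp in
variable (p G) in
theorem ordCompl_card_ne_zero : ordCompl[p] (Nat.card G) ≠ 0 := fun h =>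
  not_dvd_ordCompl_card p G (h ▸ dvd_zero p)

omit [Fintype G] in
theorem pow_ordCompl_eq_one_of_mem_roots {K V : Type*} [Field K] [IsAlgClosed K] [AddCommGroup V]
    [Module K V] [FiniteDimensional K V] (ρ : Representation K G V)
    {g : G} (hg : ¬ p ∣ orderOf g) {x : K} (hx : x ∈ (ρ g).charpoly.roots) :
    x ^ ordCompl[p] (Nat.card G) = 1 :=
  pow_eq_one_of_mem_roots_charpoly (by
    rw [← map_pow, orderOf_dvd_iff_pow_eq_one.1 (orderOf_dvd_ordCompl hg), map_one]) hx

omit [Fintype G] in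
theorem character_eq_sum_roots {K V : Type*} [Field K] [IsAlgClosed K] [AddCommGroup V]
    [Module K V] [FiniteDimensional K V] (ρ : Representation K G V) (g : G) :
    ρ.character g = (ρ g).charpoly.roots.sum :=
  Module.End.trace_eq_sum_roots_charpoly_of_splits (IsAlgClosed.splits _)

variable (p I) in
/-- The Brauer character of a representation on an arbitrary vector space. -/
noncomputable def brauerFun {V : Type*} [AddCommGroup V] [Module (Residue I) V]
    [FiniteDimensional (Residue I) V] (ρ : Representation (Residue I) G V) : G → ℂ := fun g =>
  if p ∣ orderOf g then 0
  else ((ρ g).charpoly.roots.map (liftRoot I (ordCompl[p] (Nat.card G)))).sum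

section Decomposition

omit [Fintype G] hp

variable {V : Type*} [AddCommGroup V] [Module (Residue I) V] [FiniteDimensional (Residue I) V]

theorem brauerFun_eq_of_equiv {W : Type*} [AddCommGroup W] [Module (Residue I) W]
    [FiniteDimensional (Residue I) W] {ρ : Representation (Residue I) G V}
    {σ : Representation (Residue I) G W} (e : ρ.Equiv σ) : brauerFun p I ρ = brauerFun p I σ := by
  ext g
  simp only [brauerFun, charpoly_eq_of_equiv e]

theorem brauerFun_eq_subRep_add_quotRep (ρ : Representation (Residue I) G V)
    (W : Submodule (Residue I) V) (hW : ∀ g, ∀ v ∈ W, ρ g v ∈ W) :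
    brauerFun p I ρ = brauerFun p I (subRep ρ W hW) + brauerFun p I (quotRep ρ W hW) := by
  ext g
  simp only [brauerFun, Pi.add_apply]
  split_ifs
  · simp
  · rw [charpoly_eq_subRep_mul_quotRep ρ W hW, Polynomial.roots_mul, Multiset.map_add,
      Multiset.sum_add]
    exact mul_ne_zero (LinearMap.charpoly_monic _).ne_zero (LinearMap.charpoly_monic _).ne_zero

/-- Brauer characters are additive along invariant subspaces, because eigenvalues are; induct on the
dimension as in a composition series. -/
theorem brauerFun_mem_closure (ρ : Representation (Residue I) G V) :
    brauerFun p I ρ ∈ AddSubmonoid.closure (IBr p I G) := by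
  induction hn : finrank (Residue I) V using Nat.strong_induction_on generalizing V with
  | _ n ih =>
    by_cases hirr : ρ.IsIrreducible
    · obtain ⟨m, X, ⟨e⟩⟩ := exists_equiv_fin ρ
      rw [brauerFun_eq_of_equiv e]
      exact AddSubmonoid.subset_closure ⟨m, X, IsIrreducible.of_equiv e hirr, rfl⟩
    rcases subsingleton_or_nontrivial V with hV | hV
    · have : brauerFun p I ρ = 0 := by
        ext g
        have h : (ρ g).charpoly = 1 := (LinearMap.charpoly_monic _).natDegree_eq_zero.1 (by
          rw [LinearMap.charpoly_natDegree, finrank_zero_of_subsingleton])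
        simp [brauerFun, h]
      rw [this]
      exact zero_mem _
    have h := mt (isIrreducible_iff ρ).2 hirr
    push Not at h
    obtain ⟨W, hW, hbot, htop⟩ := h hV
    rw [brauerFun_eq_subRep_add_quotRep ρ W hW]
    have h1 := Submodule.finrank_quotient_add_finrank W
    have h2 := Submodule.finrank_lt htop
    have h3 : 0 < finrank (Residue I) W := by
      have : Nontrivial W := Submodule.nontrivial_iff_ne_bot.2 hbot
      exact finrank_pos
    exact add_mem (ih _ (by omega) _ rfl) (ih _ (by omega) _ rfl)

theorem IsBrauerCharacter.mem_closure {θ : G → ℂ} (h : IsBrauerCharacter p I θ) :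
    θ ∈ AddSubmonoid.closure (IBr p I G) := by
  obtain ⟨n, X, rfl⟩ := h
  exact brauerFun_mem_closure X

theorem brauerFun_conj (ρ : Representation (Residue I) G V) (g h : G) :
    brauerFun p I ρ (h * g * h⁻¹) = brauerFun p I ρ g := by
  have h1 : orderOf (h * g * h⁻¹) = orderOf g := orderOf_injective (MulAut.conj h).toMonoidHom
    (MulAut.conj h).injective g
  let e : V ≃ₗ[Residue I] V := LinearEquiv.ofLinearMap (ρ h) (ρ h⁻¹)
    (by rw [← Module.End.mul_eq_comp, ← map_mul]; simp; rfl)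
    (by rw [← Module.End.mul_eq_comp, ← map_mul]; simp; rfl)
  have h2 : ρ (h * g * h⁻¹) = e.conj (ρ g) := by
    ext v
    simp [e, LinearEquiv.conj_apply]
  simp only [brauerFun, h1, h2, LinearEquiv.charpoly_conj]

end Decomposition

theorem exists_reduction_brauerFun {V : Type*} [AddCommGroup V] [Module (Residue I) V]
    [FiniteDimensional (Residue I) V] (ρ : Representation (Residue I) G V) (g : G) :
    ∃ t : AlgInt, (t : ℂ) = brauerFun p I ρ g ∧
      (¬ p ∣ orderOf g → Ideal.Quotient.mk I t = ρ.character g) := by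
  by_cases hg : p ∣ orderOf g
  · exact ⟨0, by simp [brauerFun, hg], fun h => absurd hg h⟩
  have key : ∀ s : Multiset (Residue I), (∀ x ∈ s, x ^ ordCompl[p] (Nat.card G) = 1) →
      ∃ t : AlgInt, (t : ℂ) = (s.map (liftRoot I (ordCompl[p] (Nat.card G)))).sum ∧
        Ideal.Quotient.mk I t = s.sum := by
    intro s
    induction s using Multiset.induction_on with
    | empty => exact fun _ => ⟨0, by simp⟩
    | cons a s ih =>
      intro h
      obtain ⟨t, ht, ht'⟩ := ih fun x hx => h x (Multiset.mem_cons_of_mem hx)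
      obtain ⟨r, -, hr, hr'⟩ := liftRoot_spec (ordCompl_card_ne_zero p G) (h a (Multiset.mem_cons_self a s))
      exact ⟨r + t, by rw [Multiset.map_cons, Multiset.sum_cons, hr', ← ht]; rfl, by simp [hr, ht']⟩
  obtain ⟨t, ht, ht'⟩ := key (ρ g).charpoly.roots fun x hx => pow_ordCompl_eq_one_of_mem_roots ρ hg hx
  exact ⟨t, by simp [brauerFun, hg, ht], fun _ => by rw [ht', character_eq_sum_roots]⟩

include hp hI in
-- The element `h` is the `p'`-part of `g`. In characteristic `p` a `p`-power root of unity is `1`,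
-- so the `p`-part of `g` does not affect eigenvalues.
theorem exists_pRegular_character_eq (g : G) : ∃ h : G, ¬ p ∣ orderOf h ∧
    ∀ (n : ℕ) (X : Representation (Residue I) G (Fin n → Residue I)),
      X.character g = X.character h := by
  have := charP_residue hI
  have hg0 : orderOf g ≠ 0 := (orderOf_pos g).ne'
  set a := ordProj[p] (orderOf g)
  set b := ordCompl[p] (orderOf g)
  have hab : a * b = orderOf g := Nat.ordProj_mul_ordCompl_eq_self _ _
  have hpb : ¬ p ∣ b := Nat.not_dvd_ordCompl hp.out hg0
  have hcop : Nat.Coprime a b := Nat.Coprime.pow_left _ ((Nat.Prime.coprime_iff_not_dvd hp.out).2 hpb)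
  -- The exponent `k` kills the `p`-part (`k ≡ 0` mod `a`) and fixes the `p'`-part (`k ≡ 1` mod
  -- `b`).
  obtain ⟨k, hka, hkb⟩ := Nat.chineseRemainder hcop 0 1
  refine ⟨g ^ k, fun h => hpb (h.trans (orderOf_dvd_of_pow_eq_one ?_)), fun n X => ?_⟩
  · rw [← pow_mul, ← orderOf_dvd_iff_pow_eq_one, ← hab]
    exact Nat.mul_dvd_mul ((Nat.modEq_zero_iff_dvd).1 hka) dvd_rfl
  · rw [character_eq_sum_roots, character_eq_sum_roots, map_pow, roots_charpoly_pow]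
    congr 1
    conv_lhs => rw [← Multiset.map_id (X g).charpoly.roots]
    refine Multiset.map_congr rfl fun x hx => ?_
    have hx1 : x ^ (b * a) = 1 := pow_eq_one_of_mem_roots_charpoly (by
      rw [mul_comm, hab, ← map_pow, pow_orderOf_eq_one, map_one]) hx
    have hxb : x ^ b = 1 := by
      rw [pow_mul] at hx1
      have h := sub_pow_char_pow (p := p) (n := (orderOf g).factorization p) (x ^ b) 1
      rw [hx1, one_pow, sub_self] at h
      exact sub_eq_zero.1 (eq_zero_of_pow_eq_zero h)
    have := pow_eq_pow_of_modEq hkb hxb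
    simpa using this.symm

include hp hI in
-- A complex relation, scaled to have coefficients in a valuation ring with one equal to `1`,
-- reduces to a nontrivial relation between irreducible characters over `F`. The density theorem
-- excludes this.
theorem linearIndependent_IBr : LinearIndependent ℂ (Subtype.val : IBr p I G → G → ℂ) := by
  classical
  rw [linearIndependent_iff']
  intro s c hc
  by_contra hne
  push Not at hne
  obtain ⟨i₁, hi₁, hci₁⟩ := hne
  obtain ⟨V, j, hj, hjI⟩ := exists_valuationSubring I (algebraMap AlgInt ℂ) Subtype.val_injective
  -- Dividing by a coefficient of maximal valuation makes all coefficients integral.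
  obtain ⟨i₀, hi₀, hmax⟩ := s.exists_max_image (fun i => V.valuation (c i)) ⟨i₁, hi₁⟩
  have hc0 : c i₀ ≠ 0 := by
    intro h0
    have := hmax i₁ hi₁
    rw [h0, map_zero, le_zero_iff, map_eq_zero] at this
    exact hci₁ this
  have hmem : ∀ i : s, c i / c i₀ ∈ V := by
    intro i
    rw [← ValuationSubring.valuation_le_one_iff, map_div₀]
    exact div_le_one_of_le₀ (hmax i i.2) zero_le
  let C : s → V := fun i => ⟨c i / c i₀, hmem i⟩
  have hC0 : C ⟨i₀, hi₀⟩ = 1 := Subtype.ext (div_self hc0)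
  choose n X hX hXeq using fun i : s => i.1.2
  have hnoequiv : ∀ i i' : s, i ≠ i' → IsEmpty ((X i).Equiv (X i')) := by
    intro i i' hii
    refine ⟨fun e => hii (Subtype.ext (Subtype.ext ?_))⟩
    rw [hXeq i, hXeq i']
    exact brauerFun_eq_of_equiv e
  obtain ⟨e, he⟩ := exists_sum_character_eq X hX hnoequiv ⟨i₀, hi₀⟩
  let ι : Residue I →+* IsLocalRing.ResidueField V :=
    Ideal.Quotient.lift I ((IsLocalRing.residue V).comp j) hjI
  have hreg : ∀ g, ¬ p ∣ orderOf g →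
      ∑ i : s, IsLocalRing.residue V (C i) * ι ((X i).character g) = 0 := by
    intro g hg
    choose t ht ht' using fun i : s => exists_reduction_brauerFun (p := p) (X i) g
    have hsum : ∑ i : s, C i * j (t i) = 0 := by
      apply Subtype.val_injective
      have h1 := congrFun hc g
      rw [← Finset.sum_coe_sort s] at h1
      simp only [Finset.sum_apply, Pi.smul_apply, smul_eq_mul, Pi.zero_apply] at h1
      have h2 : ((∑ i : s, C i * j (t i) : V) : ℂ)
          = (∑ i : s, c i * (i : IBr p I G).1 g) / c i₀ := by
        rw [Finset.sum_div]
        push_cast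
        refine Finset.sum_congr rfl fun i _ => ?_
        rw [hj, hXeq i]
        change c i / c i₀ * (t i : ℂ) = c i * brauerFun p I (X i) g / c i₀
        rw [ht]
        ring
      rw [h2, h1, zero_div]
      rfl
    have h3 := congrArg (IsLocalRing.residue V) hsum
    simp only [map_sum, map_mul, map_zero] at h3
    rw [← h3]
    refine Finset.sum_congr rfl fun i _ => ?_
    rw [← ht' i hg]
    rfl
  -- The relation, known on `p`-regular elements, extends to all of `G`, as required for pairing it
  -- with `e`.
  have hall : ∀ g, ∑ i : s, IsLocalRing.residue V (C i) * ι ((X i).character g) = 0 := by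
    intro g
    obtain ⟨h, hh, hX⟩ := exists_pRegular_character_eq hI g
    simp only [hX]
    exact hreg h hh
  have hfin : ∑ i : s, IsLocalRing.residue V (C i) * ι (∑ g, e g * (X i).character g) = 0 := by
    simp only [map_sum, map_mul, Finset.mul_sum]
    rw [Finset.sum_comm]
    refine Finset.sum_eq_zero fun g _ => ?_
    have h := congrArg (ι (e g) * ·) (hall g)
    simp only [mul_zero, Finset.mul_sum] at h
    rw [← h]
    refine Finset.sum_congr rfl fun i _ => by ring
  simp only [he] at hfin
  rw [Finset.sum_eq_single ⟨i₀, hi₀⟩ (fun i _ hi => by simp [hi]) (by simp), if_pos rfl, hC0] at hfin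
  simp at hfin

end BrauerCharacters

/-! ### Reduction modulo `I` and expansion in ordinary characters -/

section DecompositionMap

open Module Representation

/-- The `V`-span of all translates of a basis is a `G`-stable lattice. Being finitely generated and
torsion-free over a valuation ring, it is flat, hence free. -/
theorem exists_integral_form {K : Type*} [Field K] (V : ValuationSubring K) {G : Type*} [Group G]
    [Finite G] {n : ℕ} (X : Representation K G (Fin n → K)) :
    ∃ (m : ℕ) (M : G →* Matrix (Fin m) (Fin m) V),
      ∀ g, (X g).charpoly = (M g).charpoly.map V.subtype := by
  let L : Submodule V (Fin n → K) := Submodule.span V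
    (Set.range fun x : G × Fin n => X x.1 (Pi.single x.2 1))
  have hLK : Submodule.IsLattice K L := by
    refine ⟨Submodule.fg_span (Set.finite_range _), ?_⟩
    rw [eq_top_iff, ← (Pi.basisFun K (Fin n)).span_eq, Submodule.span_le]
    rintro _ ⟨i, rfl⟩
    refine Submodule.subset_span (Submodule.subset_span ⟨(1, i), ?_⟩)
    simp
  have hL : ∀ g, ∀ v ∈ L, (X g).restrictScalars V v ∈ L := by
    intro g v hv
    induction hv using Submodule.span_induction with
    | mem v hv =>
      obtain ⟨⟨h, i⟩, rfl⟩ := hv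
      refine Submodule.subset_span ⟨(g * h, i), ?_⟩
      simp
    | zero => simp
    | add v w _ _ hv hw =>
      rw [map_add]
      exact add_mem hv hw
    | smul c v _ hv =>
      rw [map_smul]
      exact L.smul_mem c hv
  have hflat : Module.Flat V L := by
    rw [Module.Flat.flat_iff_torsion_eq_bot_of_isBezout, ← Submodule.isTorsionFree_iff_torsion_eq_bot]
    infer_instance
  have hfree : Module.Free V L := Module.free_of_flat_of_isLocalRing
  let b := Module.finBasis V L
  let B := b.extendOfIsLattice K
  let M : G →* Matrix (Fin (finrank V L)) (Fin (finrank V L)) V :=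
    { toFun := fun g => LinearMap.toMatrix b b (((X g).restrictScalars V).restrict (hL g))
      map_one' := by
        rw [← LinearMap.toMatrix_one b]
        congr 1
        ext v : 2
        simp
      map_mul' := fun g h => by
        rw [← LinearMap.toMatrix_mul]
        congr 1
        ext v : 2
        simp }
  refine ⟨_, M, fun g => ?_⟩
  rw [← Matrix.charpoly_map, ← LinearMap.charpoly_toMatrix (X g) B]
  congr 1
  ext i j
  have hrepr : ∀ v : L, B.repr v i = ((b.repr v i : V) : K) := by
    intro v
    have h : (v : Fin n → K) = ∑ i, ((b.repr v i : V) : K) • B i := by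
      conv_lhs => rw [← b.sum_repr v]
      rw [Submodule.coe_sum]
      refine Finset.sum_congr rfl fun i _ => ?_
      rw [Module.Basis.extendOfIsLattice_apply]
      rfl
    rw [h, Basis.repr_sum_self]
  rw [LinearMap.toMatrix_apply, Module.Basis.extendOfIsLattice_apply]
  rw [Matrix.map_apply]
  change _ = ((LinearMap.toMatrix b b (((X g).restrictScalars V).restrict (hL g)) i j : V) : K)
  rw [LinearMap.toMatrix_apply]
  exact hrepr (((X g).restrictScalars V).restrict (hL g) (b j))

instance : IsAlgClosed AlgNum := (algebraicClosure.isAlgClosure ℚ ℂ).isAlgClosed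

variable {p : ℕ} [hp : Fact p.Prime] {I : Ideal AlgInt} [I.IsMaximal] (hI : (p : AlgInt) ∈ I)
  {G : Type*} [Group G] [Fintype G]

theorem exists_algInt_of_pow_eq_one {m : ℕ} (hm : m ≠ 0) {s : Multiset AlgNum}
    (hs : ∀ x ∈ s, x ^ m = 1) :
    ∃ R : Multiset AlgInt, (∀ r ∈ R, r ^ m = 1) ∧ s = R.map algIntToAlgNum := by
  induction s using Multiset.induction_on with
  | empty => exact ⟨0, by simp, by simp⟩
  | cons x s ih =>
    obtain ⟨R, hR, rfl⟩ := ih fun y hy => hs y (Multiset.mem_cons_of_mem hy)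
    have hx := hs x (Multiset.mem_cons_self x _)
    have hxC : (x : ℂ) ^ m = 1 := congrArg (algebraMap AlgNum ℂ) hx
    have hint : IsIntegral ℤ (x : ℂ) := IsIntegral.of_pow (Nat.pos_of_ne_zero hm) (hxC ▸ isIntegral_one)
    refine ⟨⟨(x : ℂ), hint⟩ ::ₘ R, ?_, ?_⟩
    · intro r hr
      rcases Multiset.mem_cons.1 hr with rfl | hr
      · exact Subtype.ext hxC
      · exact hR r hr
    · rw [Multiset.map_cons]
      rfl

include hp hI in
theorem regRestrict_mem_closure {χ : G → ℂ} (hχ : χ ∈ Irr G) :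
    regRestrict p χ ∈ AddSubmonoid.closure (IBr p I G) := by
  obtain ⟨n, X, -, rfl⟩ := hχ
  obtain ⟨V, j, θ, hj, hθ⟩ := exists_reduction hI
  obtain ⟨m, M, hM⟩ := exists_integral_form V X
  -- The reduction of the integral form. Its eigenvalues at a `p`-regular element are the reductions
  -- of those of `X`, and `liftRoot` recovers the originals.
  let Y : Representation (Residue I) G (Fin m → Residue I) :=
    { toFun := fun g => Matrix.toLin' (θ.mapMatrix (M g))
      map_one' := by rw [map_one, map_one, Matrix.toLin'_one]; rfl
      map_mul' := fun g h => by rw [map_mul, map_mul, Matrix.toLin'_mul]; rfl }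
  refine IsBrauerCharacter.mem_closure ⟨m, Y, ?_⟩
  ext g
  unfold regRestrict brauerChar
  split_ifs with hg
  · rfl
  obtain ⟨R, hR, hRX⟩ := exists_algInt_of_pow_eq_one (ordCompl_card_ne_zero p G)
    fun x hx => pow_ordCompl_eq_one_of_mem_roots X hg hx
  have hXprod : (X g).charpoly = (R.map fun r => Polynomial.X - Polynomial.C (algIntToAlgNum r)).prod := by
    rw [(IsAlgClosed.splits (X g).charpoly).eq_prod_roots_of_monic (LinearMap.charpoly_monic _), hRX,
      Multiset.map_map]
    rfl
  have hjc : ∀ r, V.subtype (j r) = algIntToAlgNum r := fun r => Subtype.ext (hj r)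
  have hMprod : (M g).charpoly = (R.map fun r => Polynomial.X - Polynomial.C (j r)).prod := by
    apply Polynomial.map_injective V.subtype Subtype.val_injective
    rw [← hM, hXprod, Polynomial.map_multiset_prod, Multiset.map_map]
    congr 1
    refine Multiset.map_congr rfl fun r _ => ?_
    simp [hjc]
  have hYroots : (Y g).charpoly.roots = R.map (Ideal.Quotient.mk I) := by
    have h1 : (Y g).charpoly = (M g).charpoly.map θ := by
      rw [← Matrix.charpoly_map]
      exact Matrix.charpoly_toLin' _
    rw [h1, hMprod, Polynomial.map_multiset_prod, Multiset.map_map]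
    have h2 : (R.map (Polynomial.map θ ∘ fun r => Polynomial.X - Polynomial.C (j r)))
        = (R.map (Ideal.Quotient.mk I)).map fun a => Polynomial.X - Polynomial.C a := by
      rw [Multiset.map_map]
      refine Multiset.map_congr rfl fun r _ => ?_
      simp [hθ]
    rw [h2, Polynomial.roots_multiset_prod_X_sub_C]
  change ((X.character g : AlgNum) : ℂ) = _
  rw [hYroots, Multiset.map_map, character_eq_sum_roots, hRX]
  have hlift : R.map (liftRoot I (ordCompl[p] (Nat.card G)) ∘ Ideal.Quotient.mk I)
      = R.map (fun r : AlgInt => (r : ℂ)) :=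
    Multiset.map_congr rfl fun r hr => liftRoot_mk hI (not_dvd_ordCompl_card p G) (hR r hr)
  rw [hlift]
  have hcoe : ∀ x : AlgNum, (x : ℂ) = algebraMap AlgNum ℂ x := fun x => rfl
  rw [hcoe, map_multiset_sum, Multiset.map_map]
  rfl

theorem character_inv_eq_conj {n : ℕ} (X : Representation AlgNum G (Fin n → AlgNum)) (g : G) :
    ((X.character g⁻¹ : AlgNum) : ℂ) = (starRingEnd ℂ) (X.character g : AlgNum) := by
  have hcoe : ∀ x : AlgNum, (x : ℂ) = algebraMap AlgNum ℂ x := fun x => rfl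
  have hN : Nat.card G ≠ 0 := Nat.card_pos.ne'
  -- Writing the inverse as a power makes `roots_charpoly_pow` applicable; on roots of unity
  -- inversion is complex conjugation.
  have hinv : g⁻¹ = g ^ (Nat.card G - 1) := by
    rw [inv_eq_iff_mul_eq_one, ← pow_succ', Nat.sub_one_add_one hN, pow_card_eq_one']
  rw [character_eq_sum_roots, character_eq_sum_roots, hinv, map_pow, roots_charpoly_pow, hcoe, hcoe,
    map_multiset_sum, map_multiset_sum, map_multiset_sum, Multiset.map_map, Multiset.map_map]
  congr 1
  refine Multiset.map_congr rfl fun x hx => ?_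
  have hx1 : x ^ Nat.card G = 1 := pow_eq_one_of_mem_roots_charpoly (by
    rw [← map_pow, pow_card_eq_one', map_one]) hx
  have hxC : (algebraMap AlgNum ℂ x) ^ Nat.card G = 1 := by rw [← map_pow, hx1, map_one]
  have hx0 : algebraMap AlgNum ℂ x ≠ 0 := by
    intro h0
    rw [h0, zero_pow hN] at hxC
    exact zero_ne_one hxC
  rw [Function.comp_apply, Function.comp_apply, ← Complex.inv_eq_conj (Complex.norm_eq_one_of_pow_eq_one hxC hN), map_pow]
  refine eq_inv_of_mul_eq_one_left ?_
  rw [← pow_succ, Nat.sub_one_add_one hN, hxC]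

omit [Fintype G] in
theorem Irr_eq_image : Irr G = (fun (χ : G → AlgNum) g => ((χ g : AlgNum) : ℂ)) '' irrChars AlgNum G := by
  ext χ
  constructor
  · rintro ⟨n, X, hX, rfl⟩
    exact ⟨_, ⟨n, X, hX, rfl⟩, rfl⟩
  · rintro ⟨_, ⟨n, X, hX, rfl⟩, rfl⟩
    exact ⟨n, X, hX, rfl⟩

variable (G) in
theorem Irr_finite : (Irr G).Finite := by
  rw [Irr_eq_image]
  exact irrChars_finite.image _

theorem eq_sum_charInner_smul {f : G → AlgNum} (hf : ∀ g h, f (h * g * h⁻¹) = f g) :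
    (fun g => ((f g : AlgNum) : ℂ)) =
      ∑ χ ∈ (Irr_finite G).toFinset, charInner (fun g => ((f g : AlgNum) : ℂ)) χ • χ := by
  classical
  have hcoe : ∀ x : AlgNum, (x : ℂ) = algebraMap AlgNum ℂ x := fun x => rfl
  have himg : (Irr_finite G).toFinset = irrChars_finite.toFinset.image
      fun (χ : G → AlgNum) g => ((χ g : AlgNum) : ℂ) := by
    ext χ
    simp [Irr_eq_image]
  rw [himg, Finset.sum_image (fun χ _ ψ _ h => funext fun g => Subtype.ext (congrFun h g))]
  ext g
  conv_lhs => rw [classFunction_eq_sum hf]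
  simp only [Finset.sum_apply, Pi.smul_apply, smul_eq_mul]
  rw [hcoe, map_sum]
  refine Finset.sum_congr rfl fun χ hχ => ?_
  obtain ⟨n, X, hX, rfl⟩ := irrChars_finite.mem_toFinset.1 hχ
  rw [map_mul]
  congr 1
  simp only [charInner, ← character_inv_eq_conj]
  simp only [hcoe, map_mul, map_sum, map_inv₀, map_natCast]

/-- The values are sums of roots of unity, so the expansion of class functions over `AlgNum`
applies. -/
theorem brauerFun_eq_sum_charInner_smul {V : Type*} [AddCommGroup V] [Module (Residue I) V]
    [FiniteDimensional (Residue I) V] (ρ : Representation (Residue I) G V) :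
    brauerFun p I ρ = ∑ χ ∈ (Irr_finite G).toFinset, charInner (brauerFun p I ρ) χ • χ := by
  choose t ht _ using exists_reduction_brauerFun (p := p) ρ
  have h : brauerFun p I ρ = fun g => ((algIntToAlgNum (t g) : AlgNum) : ℂ) :=
    funext fun g => (ht g).symm
  have h2 := eq_sum_charInner_smul (f := fun g => algIntToAlgNum (t g)) fun g x => by
    refine Subtype.ext ?_
    have := brauerFun_conj (p := p) ρ g x
    rw [← ht, ← ht] at this
    exact this
  rw [← h] at h2
  exact h2

end DecompositionMap

/-! ### Duality of irreducible Brauer characters and PIMs -/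

section Duality

variable {p : ℕ} [hp : Fact p.Prime] {I : Ideal AlgInt} [I.IsMaximal] (hI : (p : AlgInt) ∈ I)
  {G : Type*} [Group G] [Fintype G]

include hp hI in
-- The coordinate functional at `ψ`, complex-linear so that it can be applied to expansions whose
-- coefficients are inner products.
theorem exists_coord {ψ : G → ℂ} (hψ : ψ ∈ IBr p I G) :
    ∃ ℓ : (G → ℂ) →ₗ[ℂ] ℂ, ℓ ψ = 1 ∧ ∀ φ ∈ IBr p I G, φ ≠ ψ → ℓ φ = 0 := by
  have hli : LinearIndepOn ℂ id (IBr p I G) := linearIndependent_IBr hI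
  let b := Module.Basis.extend hli
  have hsub := hli.subset_extend (Set.subset_univ _)
  have hb : ∀ φ (hφ : φ ∈ IBr p I G), b ⟨φ, hsub hφ⟩ = φ := fun φ hφ =>
    Module.Basis.extend_apply_self hli ⟨φ, hsub hφ⟩
  have hc : ∀ φ (hφ : φ ∈ IBr p I G),
      b.coord ⟨ψ, hsub hψ⟩ φ = b.coord ⟨ψ, hsub hψ⟩ (b ⟨φ, hsub hφ⟩) := fun φ hφ =>
    congrArg _ (hb φ hφ).symm
  refine ⟨b.coord ⟨ψ, hsub hψ⟩, ?_, fun φ hφ hne => ?_⟩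
  · rw [hc ψ hψ]
    simp
  · rw [hc φ hφ, Module.Basis.coord_apply, Module.Basis.repr_self, Finsupp.single_eq_of_ne]
    exact fun h => hne (congrArg Subtype.val h).symm

omit hp [Fintype G] in
theorem coord_sum {ψ : G → ℂ} {ℓ : (G → ℂ) →ₗ[ℂ] ℂ} (h1 : ℓ ψ = 1)
    (h0 : ∀ φ ∈ IBr p I G, φ ≠ ψ → ℓ φ = 0) {d : (G → ℂ) →₀ ℕ}
    (hd : (d.support : Set (G → ℂ)) ⊆ IBr p I G) : ℓ (d.sum fun φ k => k • φ) = d ψ := by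
  rw [map_finsuppSum, Finsupp.sum, Finset.sum_eq_single ψ]
  · rw [map_nsmul, h1, nsmul_one]
  · intro φ hφ hne
    rw [map_nsmul, h0 φ (hd hφ) hne, nsmul_zero]
  · intro h
    rw [Finsupp.notMem_support_iff.1 h, zero_smul, map_zero]

include hp hI in
theorem decompNumber_spec {χ : G → ℂ} (hχ : χ ∈ Irr G) :
    ∃ d : (G → ℂ) →₀ ℕ, (d.support : Set (G → ℂ)) ⊆ IBr p I G ∧
      (regRestrict p χ = d.sum fun ψ k => k • ψ) ∧ ∀ φ, decompNumber p I χ φ = d φ := by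
  have h := mem_addSubmonoid_closure_iff.1 (regRestrict_mem_closure hI hχ)
  refine ⟨h.choose, h.choose_spec.1, h.choose_spec.2, fun φ => ?_⟩
  rw [decompNumber, dif_pos h]

omit hp in
theorem pim_eq_sum (φ : G → ℂ) :
    pim p I φ = ∑ χ ∈ (Irr_finite G).toFinset, decompNumber p I χ φ • χ :=
  finsum_mem_eq_finite_toFinset_sum _ (Irr_finite G)

omit [Group G] in
/-- The inner product with a fixed first argument, as an additive map. -/
noncomputable def charInnerHom (lam : G → ℂ) : (G → ℂ) →+ ℂ where
  toFun mu := charInner lam mu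
  map_zero' := by simp [charInner]
  map_add' x y := by simp [charInner, mul_add, Finset.sum_add_distrib]

omit [Group G] in
theorem charInnerHom_apply (lam mu : G → ℂ) : charInnerHom lam mu = charInner lam mu := rfl

omit [Group G] in
theorem charInner_sum_left {ι : Type*} (s : Finset ι) (c : ι → ℕ) (f : ι → G → ℂ) (mu : G → ℂ) :
    charInner (∑ i ∈ s, c i • f i) mu = ∑ i ∈ s, (c i : ℂ) * charInner (f i) mu := by
  simp only [charInner, Finset.sum_apply, Pi.smul_apply, Finset.sum_mul, Finset.mul_sum]
  rw [Finset.sum_comm]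
  refine Finset.sum_congr rfl fun i _ => Finset.sum_congr rfl fun g _ => by
    rw [nsmul_eq_mul]; ring

/-- The irreducible Brauer characters and the projective indecomposable characters are dual to
each other. -/
theorem charInner_pim_eq_coord {φ ψ : G → ℂ} (hφ : φ ∈ IBr p I G) {ℓ : (G → ℂ) →ₗ[ℂ] ℂ}
    (hI : (p : AlgInt) ∈ I) (h1 : ℓ ψ = 1) (h0 : ∀ φ ∈ IBr p I G, φ ≠ ψ → ℓ φ = 0) :
    charInner φ (pim p I ψ) = ℓ φ := by
  -- A Brauer character vanishes off the `p`-regular elements, so each `χ` in its expansion may be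
  -- replaced by its restriction. Applying `ℓ` then turns `χ` into `d_{χψ}`.
  have hexp : φ = ∑ χ ∈ (Irr_finite G).toFinset, charInner φ χ • regRestrict p χ := by
    obtain ⟨n, X, -, rfl⟩ := hφ
    have h := brauerFun_eq_sum_charInner_smul (p := p) X
    change brauerFun p I X = ∑ χ ∈ _, charInner (brauerFun p I X) χ • _
    ext g
    by_cases hg : p ∣ orderOf g
    · simp [regRestrict, brauerFun, hg]
    · conv_lhs => rw [h]
      simp [regRestrict, hg]
  conv_rhs => rw [hexp]
  rw [map_sum, pim_eq_sum, ← charInnerHom_apply, map_sum]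
  refine Finset.sum_congr rfl fun χ hχ => ?_
  obtain ⟨d, hd, hdχ, hdec⟩ := decompNumber_spec hI ((Irr_finite G).mem_toFinset.1 hχ)
  rw [map_nsmul, map_smul, hdχ, coord_sum h1 h0 hd, hdec, nsmul_eq_mul, smul_eq_mul, mul_comm,
    charInnerHom_apply]

include hp hI in
theorem charInner_pim_self {φ : G → ℂ} (hφ : φ ∈ IBr p I G) : charInner φ (pim p I φ) = 1 := by
  obtain ⟨ℓ, h1, h0⟩ := exists_coord hI hφ
  rw [charInner_pim_eq_coord hφ hI h1 h0, h1]

include hp hI in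
theorem charInner_pim_of_ne {φ ψ : G → ℂ} (hφ : φ ∈ IBr p I G) (hψ : ψ ∈ IBr p I G) (h : φ ≠ ψ) :
    charInner φ (pim p I ψ) = 0 := by
  obtain ⟨ℓ, h1, h0⟩ := exists_coord hI hψ
  rw [charInner_pim_eq_coord hφ hI h1 h0, h0 φ hφ h]

include hp hI in
theorem charInner_sum_pim {φ : G → ℂ} (hφ : φ ∈ IBr p I G) {m : (G → ℂ) →₀ ℕ}
    (hm : (m.support : Set (G → ℂ)) ⊆ IBr p I G) :
    charInner φ (m.sum fun ψ k => k • pim p I ψ) = m φ := by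
  rw [← charInnerHom_apply, map_finsuppSum, Finsupp.sum, Finset.sum_eq_single φ]
  · rw [map_nsmul, charInnerHom_apply, charInner_pim_self hI hφ, nsmul_one]
  · intro ψ hψ hne
    rw [map_nsmul, charInnerHom_apply, charInner_pim_of_ne hI hφ (hm hψ) hne.symm, nsmul_zero]
  · intro h
    rw [Finsupp.notMem_support_iff.1 h, zero_smul, map_zero]

include hp hI in
theorem IsProjectiveCharacter.exists_charInner_eq {φ Ψ : G → ℂ} (hφ : φ ∈ IBr p I G)
    (hΨ : IsProjectiveCharacter p I Ψ) : ∃ n : ℕ, charInner φ Ψ = n := by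
  unfold IsProjectiveCharacter at hΨ
  induction hΨ using AddSubmonoid.closure_induction with
  | mem x hx =>
    obtain ⟨ψ, hψ, rfl⟩ := hx
    by_cases h : φ = ψ
    · exact ⟨1, by rw [← h, charInner_pim_self hI hφ, Nat.cast_one]⟩
    · exact ⟨0, by rw [charInner_pim_of_ne hI hφ hψ h, Nat.cast_zero]⟩
  | zero => exact ⟨0, by simp [charInner]⟩
  | add x y _ _ hx hy =>
    obtain ⟨m, hm⟩ := hx
    obtain ⟨n, hn⟩ := hy
    exact ⟨m + n, by rw [← charInnerHom_apply, map_add, charInnerHom_apply, charInnerHom_apply,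
      hm, hn, Nat.cast_add]⟩

/-- A Brauer character that is an integral combination of `IBr(B)` is one with non-negative
coefficients. -/
theorem IsBrauerCharacter.exists_eq_sum (hI : (p : AlgInt) ∈ I) {B : Set (G → ℂ)} {s : ℕ}
    {β : Fin s → G → ℂ} (hβ : Function.Injective β) (hβ' : Set.range β = IBrBlock p I B)
    {θ : G → ℂ} (hθ : IsBrauerCharacter p I θ)
    (hspan : θ ∈ Submodule.span ℤ (IBrBlock p I B)) :
    ∃ u : Fin s → ℕ, θ = ∑ k, u k • β k := by
  classical
  obtain ⟨d, hd, hdθ⟩ := mem_addSubmonoid_closure_iff.1 hθ.mem_closure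
  refine ⟨fun k => d (β k), ?_⟩
  -- A constituent outside `B` is detected by its coordinate functional, which vanishes on the span
  -- of `IBr(B)`.
  have hsupp : d.support ⊆ Finset.univ.image β := by
    intro ψ hψ
    by_contra hn
    have hψB : ψ ∉ IBrBlock p I B := by
      rw [← hβ']
      rintro ⟨k, rfl⟩
      exact hn (Finset.mem_image_of_mem _ (Finset.mem_univ k))
    obtain ⟨ℓ, h1, h0⟩ := exists_coord hI (hd hψ)
    have hz : ℓ θ = 0 := by
      clear hθ hdθ
      induction hspan using Submodule.span_induction with
      | mem x hx => exact h0 x hx.1 fun h => hψB (h ▸ hx)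
      | zero => exact map_zero ℓ
      | add x y _ _ hx hy => rw [map_add, hx, hy, add_zero]
      | smul c x _ hx => rw [map_zsmul, hx, smul_zero]
    rw [hdθ, coord_sum h1 h0 hd] at hz
    exact Finsupp.mem_support_iff.1 hψ (Nat.cast_eq_zero.1 hz)
  rw [hdθ, Finsupp.sum_of_support_subset d hsupp _ (by simp), Finset.sum_image hβ.injOn]

end Duality

end ModChar

/-! ### The argument with the two basic sets -/

open ModChar
theorem mainTheorem10
    (p : ℕ) [Fact p.Prime] (I : Ideal AlgInt) [I.IsMaximal] (hI : (p : AlgInt) ∈ I)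
    {G : Type*} [Group G] [Fintype G]
    -- a union of blocks with two basic sets
    (B : Set (G → ℂ)) (hB : IsUnionOfBlocks p I B)
    {s : ℕ} (φ Φ : Fin s → G → ℂ)
    (hφ : IsBrauerBasicSet p I B φ) (hΦ : IsProjectiveBasicSet p I B Φ)
    -- the matrix of scalar products is lower unitriangular
    (hU : ∀ i j, i < j → charInner (φ i) (Φ j) = 0)
    (hU' : ∀ i, charInner (φ i) (Φ i) = 1)
    -- the irreducible Brauer characters of `B`, and so the PIMs of `B`, are ordered consistently
    (β : Fin s → G → ℂ) (hβ : Function.Injective β) (hβ' : Set.range β = IBrBlock p I B)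
    (b : Fin s → Fin s → ℕ)
    (hb : ∀ j, Φ j = pim p I (β j) + ∑ r ∈ Finset.Ioi j, b r j • pim p I (β r)) :
    ∃ a : Fin s → Fin s → ℕ, (∀ i j, charInner (φ i) (Φ j) = (a i j : ℂ)) ∧
      -- lower bound for the multiplicity of the `i`-th PIM in `Φ j₀`
      (∀ (v : Fin s → ℤ) (i j₀ : Fin s), IsProjectiveCharacter p I (∑ j, v j • Φ j) →
        v i < 0 → j₀ < i → 0 < v j₀ → 0 < excess a v i j₀ →
        ContainedTimes p I ⌈(excess a v i j₀ : ℚ) / (v j₀ : ℚ)⌉₊ (β i) (Φ j₀)) ∧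
      -- subtraction of `z • Φ i`, and correction
      (∀ (i j₀ : Fin s) (z : ℕ), j₀ < i → ContainedTimes p I z (β i) (Φ j₀) →
        IsProjectiveCharacter p I
          (Φ j₀ - z • Φ i + z • ∑ l ∈ Finset.Ioi i, a l i • Φ l)) := by
  classical
  have hβI : ∀ k, β k ∈ IBr p I G := fun k => by
    have h : β k ∈ IBrBlock p I B := hβ' ▸ Set.mem_range_self k
    exact h.1
  -- The full multiplicity matrix of the `Φ j`: `b` carries information only below the diagonal.
  let b' : Fin s → Fin s → ℕ := fun k j => if k = j then 1 else if j < k then b k j else 0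
  have hb'self : ∀ j, b' j j = 1 := fun j => if_pos rfl
  have hb'gt : ∀ k j, j < k → b' k j = b k j := fun k j h => by simp [b', h, h.ne']
  have hΦsum : ∀ j, Φ j = ∑ k, b' k j • pim p I (β k) := fun j => by
    rw [hb j, ← Finset.add_sum_erase _ _ (Finset.mem_univ j), hb'self, one_smul]
    congr 1
    refine (Finset.sum_subset_zero_on_sdiff (fun r hr => ?_) (fun r hr => ?_) fun r hr => ?_)
    · exact Finset.mem_erase.2 ⟨(Finset.mem_Ioi.1 hr).ne', Finset.mem_univ _⟩
    · rw [Finset.mem_sdiff, Finset.mem_erase, Finset.mem_Ioi] at hr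
      simp [b', hr.1.1, hr.2]
    · rw [hb'gt r j (Finset.mem_Ioi.1 hr)]
  have hcoef : ∀ k j, charInner (β k) (Φ j) = b' k j := fun k j => by
    rw [hΦsum j, ← charInnerHom_apply, map_sum, Finset.sum_eq_single k]
    · rw [map_nsmul, charInnerHom_apply, charInner_pim_self hI (hβI k), nsmul_one]
    · intro l _ hl
      rw [map_nsmul, charInnerHom_apply,
        charInner_pim_of_ne hI (hβI k) (hβI l) fun h => hl (hβ h).symm, nsmul_zero]
    · simp
  have hφspan : ∀ i, φ i ∈ Submodule.span ℤ (IBrBlock p I B) := fun i =>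
    hφ.span_eq ▸ Submodule.subset_span (Set.mem_range_self i)
  choose u hu using fun i =>
    (hφ.isBrauerCharacter i).exists_eq_sum hI hβ hβ' (hφspan i)
  have ha : ∀ i j, charInner (φ i) (Φ j) = ((∑ k, u i k * b' k j : ℕ) : ℂ) := fun i j => by
    rw [hu i, charInner_sum_left]
    push_cast
    exact Finset.sum_congr rfl fun k _ => by rw [hcoef]
  have hule : ∀ i k j, u i k * b' k j ≤ ∑ k, u i k * b' k j := fun i k j =>
    Finset.single_le_sum (f := fun k => u i k * b' k j) (fun _ _ => Nat.zero_le _)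
      (Finset.mem_univ k)
  -- The summand `u i j * b' j j = u i j` is bounded by the entry `a i j`, which is `0`.
  have hu0 : ∀ i j, i < j → u i j = 0 := fun i j hij => by
    have h := hule i j j
    rw [Nat.cast_eq_zero.1 ((ha i j).symm.trans (hU i j hij)), hb'self, mul_one] at h
    exact Nat.le_zero.1 h
  have hu1 : ∀ i, u i i = 1 := fun i => by
    have h : ∑ k, u i k * b' k i = 1 := Nat.cast_eq_one.1 ((ha i i).symm.trans (hU' i))
    rw [Finset.sum_eq_single i, hb'self, mul_one] at h
    · exact h
    · intro k _ hk
      rcases lt_or_gt_of_ne hk with hlt | hgt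
      · simp [b', hk, hlt.not_gt]
      · rw [hu0 i k hgt, zero_mul]
    · simp
  -- The summand `k = i` alone already gives `u i i * b' i j = b' i j`.
  have hba : ∀ i j, b' i j ≤ ∑ k, u i k * b' k j := fun i j => by
    have h := hule i i j
    rwa [hu1, one_mul] at h
  refine ⟨fun i j => ∑ k, u i k * b' k j, ha, ?_, ?_⟩
  · intro v i j₀ hproj hvi hj₀ hvj₀ hex
    obtain ⟨m, hm⟩ := hproj.exists_charInner_eq hI (hβI i)
    -- The multiplicity of the `i`-th PIM in the given projective character, hence non-negative.
    have hm' : ∑ j, v j * (b' i j : ℤ) = m := by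
      rw [← charInnerHom_apply, map_sum] at hm
      have h : ∀ j, charInnerHom (β i) (v j • Φ j) = v j * (b' i j : ℂ) := fun j => by
        rw [map_zsmul, charInnerHom_apply, hcoef, zsmul_eq_mul]
      simp only [h] at hm
      exact_mod_cast hm
    have hkey : excess (fun i j => ∑ k, u i k * b' k j) v i j₀ ≤ v j₀ * (b' i j₀ : ℤ) := by
      have h1 : ∑ j, v j * (b' i j : ℤ) ≤ v i + v j₀ * (b' i j₀ : ℤ) +
          ∑ j : Fin s with j < i ∧ j ≠ j₀ ∧ 0 < v j, v j * ((∑ k, u i k * b' k j : ℕ) : ℤ) := by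
        rw [← Finset.add_sum_erase _ _ (Finset.mem_univ i),
          ← Finset.add_sum_erase _ _ (Finset.mem_erase.2 ⟨hj₀.ne, Finset.mem_univ j₀⟩), hb'self,
          Nat.cast_one, mul_one, ← add_assoc]
        gcongr
        rw [Finset.sum_filter]
        refine (Finset.sum_le_sum fun j hj => ?_).trans
          (Finset.sum_le_sum_of_subset_of_nonneg (Finset.subset_univ _) fun j _ _ => ?_)
        · simp only [Finset.mem_erase, Finset.mem_univ, and_true] at hj
          split_ifs with h
          · exact mul_le_mul_of_nonneg_left (by exact_mod_cast hba i j) h.2.2.le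
          · by_cases hji : j < i
            · have hv : v j ≤ 0 := by
                by_contra hv
                exact h ⟨hji, hj.1, not_le.1 hv⟩
              exact mul_nonpos_of_nonpos_of_nonneg hv (Nat.cast_nonneg _)
            · have : b' i j = 0 := by simp [b', Ne.symm hj.2, hji]
              simp [this]
        · split_ifs with h
          · exact mul_nonneg h.2.2.le (Nat.cast_nonneg _)
          · exact le_rfl
      have h2 : (0 : ℤ) ≤ m := Nat.cast_nonneg m
      unfold excess
      rw [abs_of_neg hvi]
      linarith
    have hz : ⌈(excess (fun i j => ∑ k, u i k * b' k j) v i j₀ : ℚ) / (v j₀ : ℚ)⌉₊ ≤ b' i j₀ := by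
      rw [Nat.ceil_le, div_le_iff₀ (by exact_mod_cast hvj₀), mul_comm]
      exact_mod_cast hkey
    -- The witness is column `j₀` of `b'`; as `β` is injective, its value at `β i` is exactly `b' i
    -- j₀`.
    refine ⟨∑ k, Finsupp.single (β k) (b' k j₀), ?_, ?_, ?_⟩
    · intro ψ hψ
      obtain ⟨k, -, hk⟩ := Finset.mem_biUnion.1 (Finsupp.support_finsetSum hψ)
      rw [Finset.mem_singleton.1 (Finsupp.support_single_subset hk)]
      exact hβI k
    · rw [← Finsupp.sum_finsetSum_index (by simp) (fun _ _ _ => add_smul _ _ _), hΦsum]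
      exact Finset.sum_congr rfl fun k _ => by rw [Finsupp.sum_single_index (zero_smul ℕ (pim p I (β k)))]
    · refine hz.trans (le_of_eq ?_)
      rw [Finsupp.finsetSum_apply, Finset.sum_eq_single i]
      · rw [Finsupp.single_eq_same]
      · intro k _ hk
        exact Finsupp.single_eq_of_ne fun h => hk (hβ h).symm
      · simp
  · rintro i j₀ z hj₀ ⟨m, hm, hmΦ, hzm⟩
    -- By duality multiplicities are inner products, so any expression of `Φ j₀` in PIMs has the
    -- coefficient `b' i j₀` at `β i`.
    have hzb : z ≤ b' i j₀ := by
      have h := hcoef i j₀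
      rw [hmΦ, charInner_sum_pim hI (hβI i) hm] at h
      rwa [← Nat.cast_injective h]
    -- For `k < i` the left side is `0`; for `k = i` it is `z`, at most `b' i j₀`; for `k > i` the
    -- summand `l = k` suffices, since `b' k i ≤ a k i`.
    have hle : ∀ k, z * b' k i ≤
        b' k j₀ + z * ∑ l ∈ Finset.Ioi i, (∑ r, u l r * b' r i) * b' k l := by
      intro k
      rcases lt_trichotomy k i with hk | rfl | hk
      · simp [b', hk.ne, hk.not_gt]
      · rw [hb'self, mul_one]
        exact hzb.trans (Nat.le_add_right _ _)
      · refine (Nat.mul_le_mul_left z ((hba k i).trans ?_)).trans (Nat.le_add_left _ _)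
        refine le_trans (le_of_eq ?_) (Finset.single_le_sum
          (f := fun l => (∑ r, u l r * b' r i) * b' k l) (fun _ _ => Nat.zero_le _)
          (Finset.mem_Ioi.2 hk))
        rw [hb'self, mul_one]
    -- The coefficients use truncated subtraction in `ℕ`, which is exact by `hle`.
    have hsum : Φ j₀ - z • Φ i + z • ∑ l ∈ Finset.Ioi i, (∑ k, u l k * b' k i) • Φ l =
        ∑ k, (b' k j₀ + z * ∑ l ∈ Finset.Ioi i, (∑ r, u l r * b' r i) * b' k l - z * b' k i) •
          pim p I (β k) := by
      rw [sub_add_eq_add_sub, sub_eq_iff_eq_add, hΦsum j₀, hΦsum i, Finset.smul_sum (s := Finset.univ),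
        ← Finset.sum_add_distrib]
      have h1 : ∀ c : Fin s → ℕ, z • ∑ l ∈ Finset.Ioi i, c l • Φ l =
          ∑ k, (z * ∑ l ∈ Finset.Ioi i, c l * b' k l) • pim p I (β k) := fun c => by
        simp only [mul_smul, ← Finset.smul_sum, Finset.sum_smul]
        rw [Finset.sum_comm]
        simp only [← Finset.smul_sum, ← hΦsum]
      rw [h1, ← Finset.sum_add_distrib]
      refine Finset.sum_congr rfl fun k _ => ?_
      rw [← add_smul, ← mul_smul, ← add_smul, Nat.sub_add_cancel (hle k)]
    unfold IsProjectiveCharacter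
    rw [hsum]
    exact sum_mem fun k _ => nsmul_mem
      (AddSubmonoid.subset_closure (Set.mem_image_of_mem _ (hβI k))) _
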